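/- Let $n$ be a natural number and work on the unit circle $\mathbb T$ with normalised arc length. For $1\le p\le\infty$ let $H^p\subseteq L^p$ be the Hardy space (vanishing negative Fourier coefficients) and $\overline{H^p_0}=\{\overline f: f\in H^p,\ f(0)=0\}$; $(X)^n$ denotes columns of length $n$ with entries in $X$, and $L^{(p,n\times n)}$ the $n\times n$ matrices with entries in $L^p$. Let $\Theta$ be an $n\times n$ matrix inner function, i.e. a matrix with entries in $H^\infty$ with $\Theta(z)$ unitary for almost every $z\in\mathbb T$, and let $K_\Theta^q=\Theta(\overline{H^q_0})^n\cap(H^q)^n$. Let $P_\Theta$ be the orthogonal projection of $(L^2)^n$ onto $K_\Theta^2$. For $1<q<\infty$ let $P_{q+}$ be the Riesz projection of $(L^q)^n$ onto $(H^q)^n$ along $(\overline{H^q_0})^n$, let $P_{q-}=I-P_{q+}$, and put $P_{\Theta,q}=P_{q+}\Theta P_{q-}\Theta^*$. Let $p\in(2,\infty]$ and $\frac12+\frac1p=\frac1q$. For $G\in L^{(p,n\times n)}$ the formula $\tilde A_G^\Theta f=P_{\Theta,q}(Gf)$ defines a bounded linear operator $\tilde A_G^\Theta:K_\Theta^2\to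 K_\Theta^q$ (the modified matrix-valued truncated Toeplitz operator). Call $G$ the symbol of a matrix-valued truncated Toeplitz operator (MTTO) if the map $f\mapsto P_\Theta(Gf)$, defined on $K_\Theta^2\cap(H^\infty)^n$, is bounded with respect to the norm of $(L^2)^n$. Then $G\in L^{(p,n\times n)}$ is the symbol of an MTTO if and only if the image of $\tilde A_G^\Theta$ is contained in $K_\Theta^2$. Consequently, the set of those $G\in L^{(p,n\times n)}$ that are symbols of MTTOs is exactly $$\{G\in L^{(p,n\times n)}: P_{\Theta,q}(GK_\Theta^2)\subseteq(L^2)^n\}.$$ -/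

import Mathlib

open MeasureTheory AddCircle
open scoped ENNReal

noncomputable section

namespace MTTO

/-- Normalised arc-length measure on the unit circle. The circle is parametrised as
`z = exp (2πit)`, `t ∈ ℝ/ℤ`, so that `fourier k` is the function `z ↦ z ^ k`. -/
abbrev arc : Measure UnitAddCircle := haarAddCircle

/-- The scalar space `L^p` of the unit circle. -/
abbrev LpT (p : ℝ≥0∞) : Type := Lp ℂ p arc

/-- Column vectors of length `n` with entries in `L^p`. For `p = 2` the norm is the Hilbert space
norm of `(L^2)^n`. -/
abbrev LpVec (n : ℕ) (p : ℝ≥0∞) : Type := PiLp 2 (fun _ : Fin n => LpT p)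

/-- `n`-by-`n` matrices with entries in `L^p`. -/
abbrev LpMat (n : ℕ) (p : ℝ≥0∞) : Type := Matrix (Fin n) (Fin n) (LpT p)

/-- The inclusion `L^p ⊆ L^r` for `r ≤ p` (the measure is finite). -/
def lpIncl {r p : ℝ≥0∞} (h : r ≤ p) : LpT p → LpT r :=
  AddSubgroup.inclusion (Lp.antitone h)

def vecIncl {n : ℕ} {r p : ℝ≥0∞} (h : r ≤ p) (f : LpVec n p) : LpVec n r :=
  WithLp.toLp 2 fun i => lpIncl h (f i)

def matIncl {n : ℕ} {r p : ℝ≥0∞} (h : r ≤ p) (G : LpMat n p) : LpMat n r :=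
  fun i j => lpIncl h (G i j)

/-- Multiplication by `g ∈ L^p` as a linear map `L^r → L^s`, where `1/p + 1/r = 1/s`. -/
def lpMul {p r s : ℝ≥0∞} [ENNReal.HolderTriple p r s] (g : LpT p) : LpT r →ₗ[ℂ] LpT s where
  toFun f := g • f
  map_add' f₁ f₂ := Lp.add_smul g f₁ f₂
  map_smul' c f := (Lp.smul_comm c g f).symm

/-- The product `G f` of a matrix with entries in `L^p` and a vector with entries in `L^r`; its
entries are in `L^s`, `1/p + 1/r = 1/s`, by Hölder's inequality. -/
def mulVec {n : ℕ} {p r s : ℝ≥0∞} [ENNReal.HolderTriple p r s] (G : LpMat n p) :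
    LpVec n r →ₗ[ℂ] LpVec n s where
  toFun f := WithLp.toLp 2 fun i => ∑ j, (lpMul (G i j) (f j) : LpT s)
  map_add' f g := by
    refine PiLp.ext fun i => ?_
    change ∑ j, (lpMul (G i j) (f j + g j) : LpT s) =
      ∑ j, (lpMul (G i j) (f j) : LpT s) + ∑ j, (lpMul (G i j) (g j) : LpT s)
    rw [← Finset.sum_add_distrib]
    exact Finset.sum_congr rfl fun j _ => map_add _ _ _
  map_smul' c f := by
    refine PiLp.ext fun i => ?_
    change ∑ j, (lpMul (G i j) (c • f j) : LpT s) = c • ∑ j, (lpMul (G i j) (f j) : LpT s)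
    rw [Finset.smul_sum]
    exact Finset.sum_congr rfl fun j _ => map_smul _ _ _

/-- The adjoint matrix. -/
def adj {n : ℕ} {p : ℝ≥0∞} (M : LpMat n p) : LpMat n p := fun i j => star (M j i)

lemma fourierCoeff_add' {p : ℝ≥0∞} [hp : Fact (1 ≤ p)] (f g : LpT p) (k : ℤ) :
    fourierCoeff (f + g : LpT p) k = fourierCoeff f k + fourierCoeff g k := by
  rw [fourierCoeff_congr_ae (Lp.coeFn_add f g)]
  exact congrFun (fourierCoeff.add ((Lp.memLp f).integrable hp.out)
    ((Lp.memLp g).integrable hp.out)) k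

lemma fourierCoeff_smul' {p : ℝ≥0∞} (c : ℂ) (f : LpT p) (k : ℤ) :
    fourierCoeff (c • f : LpT p) k = c * fourierCoeff f k := by
  rw [fourierCoeff_congr_ae (Lp.coeFn_smul c f)]
  exact fourierCoeff.const_smul _ c k

/-- The `k`-th Fourier coefficient as a linear functional on `L^p`. -/
def coeffL {p : ℝ≥0∞} [Fact (1 ≤ p)] (k : ℤ) : LpT p →ₗ[ℂ] ℂ where
  toFun f := fourierCoeff f k
  map_add' f g := fourierCoeff_add' f g k
  map_smul' c f := fourierCoeff_smul' c f k

/-- The Hardy space `H^p`, as the space of boundary functions: those `f ∈ L^p` whose Fourier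
coefficients of negative index vanish. -/
def hardy (p : ℝ≥0∞) [Fact (1 ≤ p)] : Submodule ℂ (LpT p) where
  carrier := {f | ∀ k : ℤ, k < 0 → fourierCoeff f k = 0}
  add_mem' {f g} hf hg k hk := by rw [fourierCoeff_add', hf k hk, hg k hk, add_zero]
  zero_mem' k _ := (coeffL (p := p) k).map_zero
  smul_mem' c f hf k hk := by rw [fourierCoeff_smul', hf k hk, mul_zero]

lemma star_add' {p : ℝ≥0∞} (f g : LpT p) : star (f + g) = star f + star g := by
  apply Lp.ext
  filter_upwards [Lp.coeFn_star (f + g), Lp.coeFn_star f, Lp.coeFn_star g, Lp.coeFn_add f g,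
    Lp.coeFn_add (star f) (star g)] with x h1 h2 h3 h4 h5
  rw [h1, h5, Pi.star_apply, h4, Pi.add_apply, Pi.add_apply, h2, h3, star_add, Pi.star_apply,
    Pi.star_apply]

lemma star_smul' {p : ℝ≥0∞} (c : ℂ) (f : LpT p) : star (c • f) = star c • star f := by
  apply Lp.ext
  filter_upwards [Lp.coeFn_star (c • f), Lp.coeFn_star f, Lp.coeFn_smul c f,
    Lp.coeFn_smul (star c) (star f)] with x h1 h2 h3 h4
  rw [h1, h4, Pi.star_apply, h3, Pi.smul_apply, Pi.smul_apply, h2, star_smul, Pi.star_apply]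

lemma star_zero' {p : ℝ≥0∞} : star (0 : LpT p) = 0 := by
  simpa using star_smul' (0 : ℂ) (0 : LpT p)

/-- The space of complex conjugates of those `f ∈ H^p` with `f(0) = 0`; the value `f(0)` is the
Fourier coefficient of index `0`. -/
def conjHardyZero (p : ℝ≥0∞) [Fact (1 ≤ p)] : Submodule ℂ (LpT p) where
  carrier := {g | ∃ f ∈ hardy p, fourierCoeff f 0 = 0 ∧ g = star f}
  add_mem' := by
    rintro _ _ ⟨f, hf, hf0, rfl⟩ ⟨g, hg, hg0, rfl⟩
    exact ⟨f + g, add_mem hf hg, by rw [fourierCoeff_add', hf0, hg0, add_zero],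
      (star_add' f g).symm⟩
  zero_mem' := ⟨0, zero_mem _, (coeffL (p := p) 0).map_zero, star_zero'.symm⟩
  smul_mem' := by
    rintro c _ ⟨f, hf, hf0, rfl⟩
    exact ⟨star c • f, Submodule.smul_mem _ _ hf, by rw [fourierCoeff_smul', hf0, mul_zero],
      by rw [star_smul', star_star]⟩

/-- An `n`-by-`n` matrix inner function. -/
structure InnerFn (n : ℕ) where
  toMat : LpMat n ∞
  analytic : ∀ i j, toMat i j ∈ hardy ∞
  unitary : ∀ᵐ z ∂arc, Matrix.of (fun i j => toMat i j z) ∈ Matrix.unitaryGroup (Fin n) ℂ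

/-- The model space `K_Θ^q = Θ (conjugate of H^q_0)^n ∩ (H^q)^n`. -/
def modelSpace {n : ℕ} (Θ : InnerFn n) (q : ℝ≥0∞) [Fact (1 ≤ q)] : Submodule ℂ (LpVec n q) where
  carrier := {f | (∀ i, f i ∈ hardy q) ∧
    ∃ g : LpVec n q, (∀ i, g i ∈ conjHardyZero q) ∧ f = mulVec Θ.toMat g}
  add_mem' := by
    rintro _ _ ⟨h1, g1, hg1, rfl⟩ ⟨h2, g2, hg2, rfl⟩
    exact ⟨fun i => add_mem (h1 i) (h2 i), g1 + g2, fun i => add_mem (hg1 i) (hg2 i),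
      (map_add _ _ _).symm⟩
  zero_mem' := ⟨fun i => zero_mem _, 0, fun i => zero_mem _, (map_zero _).symm⟩
  smul_mem' := by
    rintro c _ ⟨h1, g1, hg1, rfl⟩
    exact ⟨fun i => Submodule.smul_mem _ c (h1 i), c • g1,
      fun i => Submodule.smul_mem _ c (hg1 i), (map_smul _ c _).symm⟩

lemma continuous_mulVec {n : ℕ} {p r s : ℝ≥0∞} [ENNReal.HolderTriple p r s] [Fact (1 ≤ r)]
    [Fact (1 ≤ s)] (G : LpMat n p) : Continuous (mulVec G : LpVec n r →ₗ[ℂ] LpVec n s) := by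
  refine (PiLp.continuous_toLp 2 _).comp
    (continuous_pi fun i => continuous_finsetSum _ fun j _ => ?_)
  have h : Continuous (lpMul (G i j) : LpT r →ₗ[ℂ] LpT s) :=
    AddMonoidHomClass.continuous_of_bound _ ‖G i j‖ fun f => Lp.norm_smul_le (G i j) f
  exact h.comp (PiLp.continuous_apply 2 _ j)

lemma continuous_coeff (k : ℤ) : Continuous fun f : LpT 2 => fourierCoeff f k := by
  have h : (fun f : LpT 2 => fourierCoeff f k) =
      fun f : LpT 2 => inner ℂ (fourierBasis (T := (1 : ℝ)) k) f := by
    funext f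
    rw [← fourierBasis_repr, HilbertBasis.repr_apply_apply]
  rw [h]
  exact continuous_const.inner continuous_id

lemma isClosed_hardy : IsClosed (hardy 2 : Set (LpT 2)) := by
  have h : (hardy 2 : Set (LpT 2)) = ⋂ k : ℤ, ⋂ _ : k < 0, {f : LpT 2 | fourierCoeff f k = 0} := by
    ext f
    simp only [Set.mem_iInter, Set.mem_ofPred_eq]
    exact Iff.rfl
  rw [h]
  exact isClosed_iInter fun k => isClosed_iInter fun _ =>
    isClosed_eq (continuous_coeff k) continuous_const

lemma continuous_star' : Continuous (star : LpT 2 → LpT 2) := by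
  refine AddMonoidHomClass.continuous_of_bound
    (⟨⟨star, star_zero'⟩, star_add'⟩ : LpT 2 →+ LpT 2) 1 fun f => ?_
  rw [one_mul]
  refine Lp.norm_le_norm_of_ae_le ?_
  filter_upwards [Lp.coeFn_star f] with x hx
  change ‖(star f : LpT 2) x‖ ≤ _
  rw [hx]
  simp

lemma isClosed_conjHardyZero : IsClosed (conjHardyZero 2 : Set (LpT 2)) := by
  have h : (conjHardyZero 2 : Set (LpT 2)) =
      star ⁻¹' ((hardy 2 : Set (LpT 2)) ∩ {f : LpT 2 | fourierCoeff f 0 = 0}) := by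
    ext g
    constructor
    · rintro ⟨f, hf, hf0, rfl⟩
      simpa using And.intro hf hf0
    · rintro ⟨h1, h2⟩
      exact ⟨star g, h1, h2, (star_star g).symm⟩
  rw [h]
  exact (isClosed_hardy.inter (isClosed_eq (continuous_coeff 0) continuous_const)).preimage
    continuous_star'

lemma coeFn_sum {ι : Type} {s : ℝ≥0∞} (t : Finset ι) (F : ι → LpT s) :
    ⇑(∑ j ∈ t, F j) =ᵐ[arc] fun z => ∑ j ∈ t, F j z := by
  classical
  induction t using Finset.induction_on with
  | empty => exact Lp.coeFn_zero ℂ s arc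
  | insert a t ha ih =>
    rw [Finset.sum_insert ha]
    filter_upwards [Lp.coeFn_add (F a) (∑ j ∈ t, F j), ih] with z h1 h2
    rw [h1, Pi.add_apply, h2, Finset.sum_insert ha]

lemma coeFn_mulVec {n : ℕ} {p r s : ℝ≥0∞} [ENNReal.HolderTriple p r s] (G : LpMat n p)
    (f : LpVec n r) (i : Fin n) :
    (mulVec G f : LpVec n s) i =ᵐ[arc] fun z => ∑ j, G i j z * f j z := by
  have h : ∀ᵐ z ∂arc, ∀ j, (lpMul (G i j) (f j) : LpT s) z = G i j z * f j z :=
    ae_all_iff.2 fun j => Lp.coeFn_lpSMul (G i j) (f j)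
  have h2 := coeFn_sum Finset.univ fun j => (lpMul (G i j) (f j) : LpT s)
  filter_upwards [h, h2] with z h h2
  exact h2.trans (Finset.sum_congr rfl fun j _ => h j)

lemma mulVec_mulVec_eq {n : ℕ} {q : ℝ≥0∞} (A B : LpMat n ∞)
    (h : ∀ᵐ z ∂arc, Matrix.of (fun i j => A i j z) * Matrix.of (fun i j => B i j z) = 1)
    (f : LpVec n q) : (mulVec A (mulVec B f : LpVec n q) : LpVec n q) = f := by
  ext1 i
  apply Lp.ext
  have hB : ∀ᵐ z ∂arc, ∀ j, (mulVec B f : LpVec n q) j z = ∑ l, B j l z * f l z :=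
    ae_all_iff.2 fun j => coeFn_mulVec B f j
  filter_upwards [h, hB, coeFn_mulVec (s := q) A (mulVec B f : LpVec n q) i] with z h hB hA
  rw [hA]
  have := congrFun (congrArg (fun M => Matrix.mulVec M fun l => f l z) h) i
  rw [← Matrix.mulVec_mulVec, Matrix.one_mulVec] at this
  rw [← this]
  simp [Matrix.mulVec, dotProduct, hB]

lemma adj_apply {n : ℕ} (M : LpMat n ∞) : ∀ᵐ z ∂arc,
    Matrix.of (fun i j => adj M i j z) = star (Matrix.of (fun i j => M i j z)) := by
  have h : ∀ᵐ z ∂arc, ∀ i j, (star (M j i) : LpT ∞) z = star (M j i z) :=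
    ae_all_iff.2 fun i => ae_all_iff.2 fun j => Lp.coeFn_star (M j i)
  filter_upwards [h] with z h
  ext i j
  exact h i j

lemma isClosed_modelSpace {n : ℕ} (Θ : InnerFn n) :
    IsClosed (modelSpace Θ 2 : Set (LpVec n 2)) := by
  have h1 : ∀ f : LpVec n 2, (mulVec (adj Θ.toMat) (mulVec Θ.toMat f : LpVec n 2)) = f := by
    refine mulVec_mulVec_eq _ _ ?_
    filter_upwards [adj_apply Θ.toMat, Θ.unitary] with z h h'
    rw [h]
    exact h'.1
  have h2 : ∀ f : LpVec n 2, (mulVec Θ.toMat (mulVec (adj Θ.toMat) f : LpVec n 2)) = f := by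
    refine mulVec_mulVec_eq _ _ ?_
    filter_upwards [adj_apply Θ.toMat, Θ.unitary] with z h h'
    rw [h]
    exact h'.2
  have h : (modelSpace Θ 2 : Set (LpVec n 2)) =
      (⋂ i, (fun f : LpVec n 2 => f i) ⁻¹' hardy 2) ∩
        (⋂ i, (fun f : LpVec n 2 => (mulVec (adj Θ.toMat) f : LpVec n 2) i) ⁻¹'
          conjHardyZero 2) := by
    ext f
    simp only [Set.mem_inter_iff, Set.mem_iInter, Set.mem_preimage, SetLike.mem_coe]
    constructor
    · rintro ⟨hf, g, hg, rfl⟩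
      exact ⟨hf, by rw [h1]; exact hg⟩
    · rintro ⟨hf, hg⟩
      exact ⟨hf, _, hg, (h2 f).symm⟩
  rw [h]
  refine (isClosed_iInter fun i => isClosed_hardy.preimage (PiLp.continuous_apply 2 _ i)).inter
    (isClosed_iInter fun i => isClosed_conjHardyZero.preimage
      ((PiLp.continuous_apply 2 _ i).comp (continuous_mulVec _)))

instance {n : ℕ} (Θ : InnerFn n) : CompleteSpace (modelSpace Θ 2) :=
  (isClosed_modelSpace Θ).completeSpace_coe

open Classical in
/-- The Riesz projection of `L^q` onto `H^q` along the conjugate of `H^q_0`. For `1 < q < ∞` every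
`f ∈ L^q` has exactly one splitting `f = g + (f - g)` of the required kind, by the theorem of
M. Riesz; the default value is then never used. -/
def rieszPlus {q : ℝ≥0∞} [Fact (1 ≤ q)] (f : LpT q) : LpT q :=
  if h : ∃ g ∈ hardy q, f - g ∈ conjHardyZero q then h.choose else 0

/-- The Riesz projection `P_{q+}` on vectors, acting in each entry. -/
def rieszPlusVec {n : ℕ} {q : ℝ≥0∞} [Fact (1 ≤ q)] (f : LpVec n q) : LpVec n q :=
  WithLp.toLp 2 fun i => rieszPlus (f i)

/-- `P_{q-} = I - P_{q+}`. -/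
def rieszMinusVec {n : ℕ} {q : ℝ≥0∞} [Fact (1 ≤ q)] (f : LpVec n q) : LpVec n q :=
  f - rieszPlusVec f

/-- `P_{Θ,q} = P_{q+} Θ P_{q-} Θ^*`. -/
def modelProj {n : ℕ} (Θ : InnerFn n) {q : ℝ≥0∞} [Fact (1 ≤ q)] (f : LpVec n q) : LpVec n q :=
  rieszPlusVec (mulVec Θ.toMat (rieszMinusVec (mulVec (adj Θ.toMat) f : LpVec n q)) : LpVec n q)

/-- The modified operator `f ↦ P_{Θ,q} (G f)` on `K_Θ^2`, where `G` has entries in `L^p` and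
`1/2 + 1/p = 1/q`. -/
def modifiedMTTO {n : ℕ} (Θ : InnerFn n) {p : ℝ≥0∞} (q : ℝ≥0∞) [Fact (1 ≤ q)]
    [ENNReal.HolderTriple p 2 q] (G : LpMat n p) (f : modelSpace Θ 2) : LpVec n q :=
  modelProj Θ (mulVec G (f : LpVec n 2) : LpVec n q)

/-- `G`, with entries in `L^2`, is the symbol of a matrix-valued truncated Toeplitz operator: the
map `f ↦ P_Θ (G f)`, defined on `K_Θ^2 ∩ (H^∞)^n`, is bounded in the norm of `(L^2)^n`. Here `P_Θ`
is the orthogonal projection of `(L^2)^n` onto `K_Θ^2`. -/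
def IsMTTO {n : ℕ} (Θ : InnerFn n) (G : LpMat n 2) : Prop :=
  ∃ C : ℝ, ∀ f : LpVec n ∞, (∀ i, f i ∈ hardy ∞) → vecIncl le_top f ∈ modelSpace Θ 2 →
    ‖(modelSpace Θ 2).starProjection (mulVec G f : LpVec n 2)‖ ≤
      C * ‖(vecIncl le_top f : LpVec n 2)‖

/-- `g ∈ (L^q)^n` lies in `(L^2)^n`. -/
def MemL2 {n : ℕ} {q : ℝ≥0∞} (g : LpVec n q) : Prop :=
  ∀ i, (g i : UnitAddCircle →ₘ[arc] ℂ) ∈ Lp ℂ 2 arc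

/-- `g ∈ (L^q)^n` lies in `K_Θ^2`. -/
def MemModelSpaceTwo {n : ℕ} (Θ : InnerFn n) {q : ℝ≥0∞} (g : LpVec n q) : Prop :=
  ∃ h ∈ modelSpace Θ 2, ∀ i, (h i : UnitAddCircle →ₘ[arc] ℂ) = (g i : UnitAddCircle →ₘ[arc] ℂ)

end MTTO

end

/-! Since `2 < p`, the exponent satisfies `1 < q ≤ 2`. The theorem rests on three facts: `P_{Θ,q}`
is bounded on `(L^q)^n` with values in `K_Θ^q` (`modelProjL_mem`); on `(L^2)^n` it agrees with the
orthogonal projection `P_Θ` (`starProjection_modelSpace`, `modelProjL_vecIncl`); and bounded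
functions are dense in `K_Θ^2` (`mem_closure_bounded`). Hence `P_Θ(Gf)` and the modified operator
give the same function for every bounded `f` in `K_Θ^2`.

If `f ↦ P_Θ(Gf)` is bounded, approximate `f` in `K_Θ^2` by bounded `f_m`. The images are Cauchy in
`L^2`, so they converge to some `y` in `K_Θ^2`; their `L^q` limit is the modified operator at `f`,
which is therefore `y`. Conversely, if the image lies in `K_Θ^2`, the operator from `K_Θ^2` to `L^2`
has closed graph, because `L^2 → L^q` is continuous and injective, so it is bounded. The description
of the set of symbols follows from `K_Θ^q ∩ (L^2)^n = K_Θ^2`.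

The analytic input is the theorem of M. Riesz for `1 < q ≤ 2`. For `f ≥ 0` with Herglotz extension
`F`, the inequality `|w|^q ≤ A (Re w)^q - B Re (w^q)` on the right half-plane
(`exists_rpow_norm_le`) is integrated over circles. The mean of `F^q` is `F(0)^q ≥ 0`, so the last
term can be dropped. Letting the radius tend to `1` bounds `F` by its real part `f`. -/

noncomputable section

namespace MTTO

variable {p q r : ℝ≥0∞} {n : ℕ}

/-! ### Inclusions of `L^p` spaces and Fourier coefficients as bounded functionals -/

lemma coeFn_lpIncl (h : r ≤ p) (f : LpT p) : (lpIncl h f : UnitAddCircle → ℂ) = f := rfl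

lemma lpIncl_injective (h : r ≤ p) : Function.Injective (lpIncl h) :=
  AddSubgroup.inclusion_injective _

lemma norm_lpIncl_le (h : r ≤ p) (f : LpT p) : ‖lpIncl h f‖ ≤ ‖f‖ := by
  rw [Lp.norm_def, Lp.norm_def]
  exact ENNReal.toReal_mono (Lp.eLpNorm_ne_top f)
    (eLpNorm_le_eLpNorm_of_exponent_le h (Lp.aestronglyMeasurable f))

/-- The inclusion `L^p ⊆ L^r` as a bounded operator. -/
def lpInclL [Fact (1 ≤ r)] [Fact (1 ≤ p)] (h : r ≤ p) : LpT p →L[ℂ] LpT r :=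
  LinearMap.mkContinuous
    { toFun := lpIncl h
      map_add' := fun _ _ => rfl
      map_smul' := fun _ _ => rfl } 1 fun f => by
    rw [one_mul]; exact norm_lpIncl_le h f

@[simp] lemma lpInclL_apply [Fact (1 ≤ r)] [Fact (1 ≤ p)] (h : r ≤ p) (f : LpT p) :
    lpInclL h f = lpIncl h f := rfl

lemma fourierCoeff_star (f : LpT p) (k : ℤ) :
    fourierCoeff (star f : LpT p) k = star (fourierCoeff f (-k)) := by
  rw [fourierCoeff_congr_ae (Lp.coeFn_star f), fourierCoeff, fourierCoeff]
  change _ = (starRingEnd ℂ) _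
  rw [← integral_conj]
  refine integral_congr_ae (Filter.Eventually.of_forall fun x => ?_)
  simp

lemma mem_conjHardyZero_iff [Fact (1 ≤ p)] {g : LpT p} :
    g ∈ conjHardyZero p ↔ ∀ k : ℤ, 0 ≤ k → fourierCoeff g k = 0 := by
  constructor
  · rintro ⟨f, hf, hf0, rfl⟩ k hk
    rw [fourierCoeff_star]
    rcases hk.eq_or_lt with rfl | hk
    · simp [hf0]
    · rw [hf _ (by lia), star_zero]
  · intro h
    refine ⟨star g, fun k hk => ?_, ?_, (star_star g).symm⟩
    · rw [fourierCoeff_star, h _ (by lia), star_zero]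
    · rw [fourierCoeff_star, neg_zero, h _ le_rfl, star_zero]

lemma lpIncl_mem_conjHardyZero [Fact (1 ≤ r)] [Fact (1 ≤ p)] (h : r ≤ p) {f : LpT p} :
    lpIncl h f ∈ conjHardyZero r ↔ f ∈ conjHardyZero p := by
  rw [mem_conjHardyZero_iff, mem_conjHardyZero_iff]; rfl

lemma norm_fourierCoeff_le [hp : Fact (1 ≤ p)] (f : LpT p) (k : ℤ) :
    ‖fourierCoeff f k‖ ≤ ‖f‖ := by
  have h1 : ‖fourierCoeff f k‖ ≤ ∫ x, ‖f x‖ ∂arc := by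
    refine (norm_integral_le_integral_norm _).trans_eq (integral_congr_ae ?_)
    refine Filter.Eventually.of_forall fun x => ?_
    change ‖fourier (-k) x • f x‖ = ‖f x‖
    rw [norm_smul, fourier_apply, Circle.norm_coe, one_mul]
  refine h1.trans ((?_ : _ = ‖lpIncl hp.out f‖).trans_le (norm_lpIncl_le hp.out f))
  rw [L1.norm_eq_integral_norm]
  rfl

/-- The `k`-th Fourier coefficient as a bounded functional on `L^p`. -/
def coeffCLM [Fact (1 ≤ p)] (k : ℤ) : LpT p →L[ℂ] ℂ :=
  (coeffL k).mkContinuous 1 fun f => by rw [one_mul]; exact norm_fourierCoeff_le f k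

@[simp] lemma coeffCLM_apply [Fact (1 ≤ p)] (k : ℤ) (f : LpT p) :
    coeffCLM k f = fourierCoeff f k := rfl

lemma isClosed_hardy' [Fact (1 ≤ p)] : IsClosed (hardy p : Set (LpT p)) := by
  have h : (hardy p : Set (LpT p)) = ⋂ k : ℤ, ⋂ _ : k < 0, {f : LpT p | coeffCLM k f = 0} := by
    ext f
    simp only [Set.mem_iInter]
    exact Iff.rfl
  rw [h]
  exact isClosed_iInter fun k => isClosed_iInter fun _ =>
    isClosed_eq (coeffCLM k).continuous continuous_const

lemma isClosed_conjHardyZero' [Fact (1 ≤ p)] : IsClosed (conjHardyZero p : Set (LpT p)) := by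
  have h : (conjHardyZero p : Set (LpT p)) =
      ⋂ k : ℤ, ⋂ _ : 0 ≤ k, {f : LpT p | coeffCLM k f = 0} := by
    ext f
    simp only [Set.mem_iInter]
    exact mem_conjHardyZero_iff
  rw [h]
  exact isClosed_iInter fun k => isClosed_iInter fun _ =>
    isClosed_eq (coeffCLM k).continuous continuous_const

lemma lpMul_coeFn {s : ℝ≥0∞} [ENNReal.HolderTriple p r s] (g : LpT p) (f : LpT r) :
    (lpMul g f : LpT s) =ᵐ[arc] fun z => g z * f z :=
  Lp.coeFn_lpSMul g f

lemma norm_lpMul_le {s : ℝ≥0∞} [ENNReal.HolderTriple p r s] (g : LpT p) (f : LpT r) :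
    ‖(lpMul g f : LpT s)‖ ≤ ‖g‖ * ‖f‖ :=
  Lp.norm_smul_le g f

lemma continuous_lpMul {s : ℝ≥0∞} [ENNReal.HolderTriple p r s] [Fact (1 ≤ r)]
    [Fact (1 ≤ s)] (g : LpT p) : Continuous (lpMul g : LpT r →ₗ[ℂ] LpT s) :=
  AddMonoidHomClass.continuous_of_bound _ ‖g‖ fun f => norm_lpMul_le g f

/-! ### Uniqueness of Fourier coefficients and coefficients of products -/

/-- The function `z ^ k` as an element of `L^p`. -/
abbrev mono (p : ℝ≥0∞) [Fact (1 ≤ p)] (k : ℤ) : LpT p := fourierLp (T := (1 : ℝ)) p k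

lemma fourierCoeff_fourierLp [Fact (1 ≤ p)] (k m : ℤ) :
    fourierCoeff (mono p k) m = if m = k then 1 else 0 := by
  rw [fourierCoeff_congr_ae (coeFn_fourierLp p k), fourierCoeff_fourier]
  simp [Pi.single_apply]

lemma fourierCoeff_lpMul_fourierLp {s : ℝ≥0∞} [ENNReal.HolderTriple p r s] [Fact (1 ≤ r)]
    (g : LpT p) (k m : ℤ) :
    fourierCoeff (lpMul g (mono r k) : LpT s) m = fourierCoeff g (m - k) := by
  rw [fourierCoeff, fourierCoeff]
  refine integral_congr_ae ?_
  filter_upwards [lpMul_coeFn (s := s) g (mono r k), coeFn_fourierLp (T := (1 : ℝ)) r k]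
    with x h1 h2
  rw [h1, h2, show -(m - k) = -m + k by ring, fourier_add]
  simp only [smul_eq_mul]; ring

/-- An element of `L^q`, `q > 1`, is determined by its Fourier coefficients. -/
lemma eq_zero_of_fourierCoeff_eq_zero [Fact (1 ≤ q)] (hq : 1 < q) {f : LpT q}
    (h : ∀ k, fourierCoeff f k = 0) : f = 0 := by
  have hc : ENNReal.HolderConjugate q (ENNReal.conjExponent q) :=
    ENNReal.HolderConjugate.conjExponent hq.le
  set q' := ENNReal.conjExponent q
  have : Fact (1 ≤ q') := ⟨ENNReal.HolderConjugate.one_le q' q⟩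
  -- This is where `1 < q` enters: trigonometric polynomials are dense in `L^{q'}` only for finite
  -- `q'`. Density makes the pairing with `f` vanish, and indicator functions then show `f = 0`.
  have hq' : q' ≠ ∞ := by
    rw [Ne, ENNReal.HolderConjugate.eq_top_iff_eq_one q' q]; exact hq.ne'
  let Φ : LpT q' →L[ℂ] ℂ := (coeffCLM (p := 1) 0).comp
    ⟨(lpMul f : LpT q' →ₗ[ℂ] LpT 1), continuous_lpMul f⟩
  have hΦ : Φ = 0 := by
    refine ContinuousLinearMap.ext_on
      (s := Set.range (mono q')) ?_ ?_
    · rw [dense_iff_closure_eq, ← Submodule.topologicalClosure_coe,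
        span_fourierLp_closure_eq_top hq']
      rfl
    · rintro _ ⟨k, rfl⟩
      change fourierCoeff (lpMul f (mono q' k) : LpT 1) 0 = 0
      rw [fourierCoeff_lpMul_fourierLp, h]
  rw [Lp.eq_zero_iff_ae_eq_zero]
  refine Integrable.ae_eq_zero_of_forall_setIntegral_eq_zero
    ((Lp.memLp f).integrable hq.le) fun s hs _ => ?_
  have h1 : Φ (indicatorConstLp q' hs (measure_ne_top arc s) (1 : ℂ)) = 0 := by rw [hΦ]; rfl
  rw [← h1, ← integral_indicator hs]
  refine integral_congr_ae ?_
  filter_upwards [lpMul_coeFn (s := 1) f (indicatorConstLp q' hs (measure_ne_top arc s) (1 : ℂ)),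
    indicatorConstLp_coeFn (p := q') (hs := hs) (hμs := measure_ne_top arc s) (c := (1 : ℂ))]
    with x h2 h3
  change _ = fourier (-0) x • (lpMul f _ : LpT 1) x
  rw [h2, h3]
  by_cases hx : x ∈ s <;> simp [hx]

lemma ext_fourierCoeff [Fact (1 ≤ q)] (hq : 1 < q) {f g : LpT q}
    (h : ∀ k, fourierCoeff f k = fourierCoeff g k) : f = g := by
  rw [← sub_eq_zero]
  refine eq_zero_of_fourierCoeff_eq_zero hq fun k => ?_
  rw [← coeffCLM_apply, map_sub, coeffCLM_apply, coeffCLM_apply, h, sub_self]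

/-- Only the `L^2` factor is expanded: its Fourier series converges in norm and is pushed through
the bounded functional sending `u` to the `m`-th coefficient of `g u`. -/
lemma hasSum_fourierCoeff_lpMul {s : ℝ≥0∞} [ENNReal.HolderTriple p 2 s] [Fact (1 ≤ s)]
    (g : LpT p) (f : LpT 2) (m : ℤ) :
    HasSum (fun k => fourierCoeff f k * fourierCoeff g (m - k))
      (fourierCoeff (lpMul g f : LpT s) m) := by
  have h := ((coeffCLM (p := s) m).comp
    ⟨(lpMul g : LpT 2 →ₗ[ℂ] LpT s), continuous_lpMul g⟩).hasSum (hasSum_fourier_series_L2 f)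
  refine h.congr_fun fun k => ?_
  rw [map_smul, smul_eq_mul]
  change _ = _ * fourierCoeff (lpMul g (mono 2 k) : LpT s) m
  rw [fourierCoeff_lpMul_fourierLp]

/-- For `m < 0` one of the indices `k`, `m - k` is negative, so every term of the convolution
vanishes. -/
lemma lpMul_mem_hardy_two {g : LpT ∞} {f : LpT 2} (hg : g ∈ hardy ∞) (hf : f ∈ hardy 2) :
    (lpMul g f : LpT 2) ∈ hardy 2 := by
  intro m hm
  refine (hasSum_fourierCoeff_lpMul (s := 2) g f m).unique ?_
  convert hasSum_zero with k
  by_cases hk : k < 0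
  · rw [hf k hk, zero_mul]
  · rw [hg (m - k) (by lia), mul_zero]

lemma lpMul_mem_conjHardyZero_two {g : LpT ∞} {f : LpT 2} (hg : g ∈ hardy ∞)
    (hf : f ∈ conjHardyZero 2) : (lpMul (star g) f : LpT 2) ∈ conjHardyZero 2 := by
  rw [mem_conjHardyZero_iff] at hf ⊢
  intro m hm
  refine (hasSum_fourierCoeff_lpMul (s := 2) (star g) f m).unique ?_
  convert hasSum_zero with k
  by_cases hk : 0 ≤ k
  · rw [hf k hk, zero_mul]
  · rw [fourierCoeff_star, hg _ (by lia), star_zero, mul_zero]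

/-! ### The inequality of M. Riesz: pointwise form, Herglotz extension, dilations -/

/-- With `θ = arg w`, the claim reduces to `1 ≤ A cos^q θ - B cos (qθ)` for `|θ| < π/2`. Choose `θ₀
< π/2` with `qθ₀ > π/2`. For `|θ| ≥ θ₀` the number `cos (qθ)` is at most `cos (qθ₀) < 0`, where `q ≤
2` keeps `q|θ|` below `π`; for `|θ| ≤ θ₀` the cosine of `θ` is bounded below. -/
lemma exists_rpow_norm_le {q : ℝ} (hq1 : 1 < q) (hq2 : q ≤ 2) :
    ∃ A B : ℝ, 0 ≤ A ∧ 0 ≤ B ∧ ∀ w : ℂ, 0 < w.re →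
      ‖w‖ ^ q ≤ A * w.re ^ q - B * (w ^ (q : ℂ)).re := by
  have hq0 : 0 < q := by linarith
  have hpi := Real.pi_pos
  obtain ⟨θ₀, h1, h2⟩ : ∃ θ₀ : ℝ, Real.pi / 2 < θ₀ * q ∧ θ₀ < Real.pi / 2 := by
    have : Real.pi / 2 / q < Real.pi / 2 := div_lt_self (by linarith) hq1
    obtain ⟨θ₀, ha, hb⟩ := exists_between this
    exact ⟨θ₀, (div_lt_iff₀ hq0).1 ha, hb⟩
  have h0 : 0 < θ₀ := by
    by_contra h
    have := mul_nonpos_of_nonpos_of_nonneg (not_lt.1 h) hq0.le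
    linarith
  have hle : θ₀ * q ≤ Real.pi := by nlinarith
  have hκ : Real.cos (θ₀ * q) < 0 := Real.cos_neg_of_pi_div_two_lt_of_lt h1 (by linarith)
  have hc : 0 < Real.cos θ₀ := Real.cos_pos_of_mem_Ioo ⟨by linarith, h2⟩
  -- `B` makes `-B cos (qθ) ≥ 1` when `|θ| ≥ θ₀`; `A` below makes the first term at least `1 + B`
  -- when `|θ| ≤ θ₀`.
  set B := (-Real.cos (θ₀ * q))⁻¹ with hB
  have hB0 : 0 ≤ B := inv_nonneg.2 (by linarith)
  have hBκ : B * -Real.cos (θ₀ * q) = 1 := inv_mul_cancel₀ (by linarith)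
  have hcq : 0 < Real.cos θ₀ ^ q := Real.rpow_pos_of_pos hc q
  set A := (1 + B) / Real.cos θ₀ ^ q with hA
  have hA0 : 0 ≤ A := by positivity
  refine ⟨A, B, hA0, hB0, fun w hw => ?_⟩
  have harg : |w.arg| < Real.pi / 2 := Complex.abs_arg_lt_pi_div_two_iff.2 (Or.inl hw)
  have hcos : 0 < Real.cos w.arg := Real.cos_pos_of_mem_Ioo (abs_lt.1 harg)
  rw [Complex.cpow_ofReal_re, ← Complex.norm_mul_cos_arg w,
    Real.mul_rpow (norm_nonneg w) hcos.le]
  have key : 1 ≤ A * Real.cos w.arg ^ q - B * Real.cos (w.arg * q) := by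
    rcases le_total |w.arg| θ₀ with h | h
    · have e1 : Real.cos θ₀ ≤ Real.cos w.arg := by
        rw [← Real.cos_abs w.arg]
        exact Real.cos_le_cos_of_nonneg_of_le_pi (abs_nonneg _) (by linarith) h
      have e2 : Real.cos θ₀ ^ q ≤ Real.cos w.arg ^ q := Real.rpow_le_rpow hc.le e1 hq0.le
      have e3 : 1 + B ≤ A * Real.cos w.arg ^ q := by
        calc 1 + B = A * Real.cos θ₀ ^ q := by rw [hA]; field_simp
          _ ≤ _ := mul_le_mul_of_nonneg_left e2 hA0
      have e4 : B * Real.cos (w.arg * q) ≤ B := mul_le_of_le_one_right hB0 (Real.cos_le_one _)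
      linarith
    · have e1 : Real.cos (w.arg * q) ≤ Real.cos (θ₀ * q) := by
        rw [← Real.cos_abs (w.arg * q), abs_mul, abs_of_pos hq0]
        refine Real.cos_le_cos_of_nonneg_of_le_pi (by positivity) ?_ (by gcongr)
        nlinarith
      have e2 : 0 ≤ A * Real.cos w.arg ^ q := by positivity
      have e3 := mul_le_mul_of_nonneg_left e1 hB0
      linarith
  calc ‖w‖ ^ q = ‖w‖ ^ q * 1 := (mul_one _).symm
    _ ≤ ‖w‖ ^ q * (A * Real.cos w.arg ^ q - B * Real.cos (w.arg * q)) :=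
        mul_le_mul_of_nonneg_left key (by positivity)
    _ = _ := by ring

lemma integral_arc_eq_circleAverage (g : ℂ → ℂ) (r : ℝ) :
    ∫ t : UnitAddCircle, g (r * fourier 1 t) ∂arc = Real.circleAverage g 0 r := by
  have h := fourierCoeff_eq_intervalIntegral (T := 1)
    (fun t : UnitAddCircle => g (r * fourier 1 t)) 0 0
  rw [fourierCoeff] at h
  simp only [neg_zero, fourier_zero, one_smul, zero_add, div_one] at h
  rw [h, Real.circleAverage_def]
  have h2 := intervalIntegral.integral_comp_mul_left (a := 0) (b := 1)
    (fun θ => g (circleMap 0 r θ)) (c := 2 * Real.pi) (by positivity)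
  rw [mul_zero, mul_one] at h2
  rw [← h2]
  refine intervalIntegral.integral_congr fun x _ => ?_
  simp only [fourier_coe_apply, circleMap]
  congr 2
  simp only [zero_add]
  congr 2
  push_cast
  ring

lemma summable_mul_pow {b : ℕ → ℂ} {M r : ℝ} (hb : ∀ k, ‖b k‖ ≤ M) (h0 : 0 ≤ r) (hr : r < 1) :
    Summable fun k => ‖b k‖ * r ^ k :=
  ((summable_geometric_of_lt_one h0 hr).mul_left M).of_nonneg_of_le
    (fun k => by positivity) fun k => mul_le_mul_of_nonneg_right (hb k) (by positivity)

lemma differentiableOn_tsum_mul_pow {b : ℕ → ℂ} {M r : ℝ} (hb : ∀ k, ‖b k‖ ≤ M)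
    (hr : r < 1) : DifferentiableOn ℂ (fun z => ∑' k, b k * z ^ k) (Metric.ball 0 r) := by
  rcases le_or_gt r 0 with h0 | h0
  · rw [Metric.ball_eq_empty.2 h0]; exact differentiableOn_empty
  refine Complex.differentiableOn_tsum_of_summable_norm (summable_mul_pow hb h0.le hr)
    (fun k => by fun_prop) Metric.isOpen_ball fun k w hw => ?_
  rw [norm_mul, norm_pow]
  have : ‖w‖ ≤ r := (mem_ball_zero_iff.1 hw).le
  gcongr

/-- The coefficients of `(1 + w) / (1 - w)`. -/
def herglotzCoeff (k : ℕ) : ℂ := if k = 0 then 1 else 2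

lemma norm_herglotzCoeff_le (k : ℕ) : ‖herglotzCoeff k‖ ≤ 2 := by
  unfold herglotzCoeff; split_ifs <;> simp

lemma hasSum_herglotz {w : ℂ} (hw : ‖w‖ < 1) :
    HasSum (fun k => herglotzCoeff k * w ^ k) ((1 + w) / (1 - w)) := by
  have h1 := (hasSum_geometric_of_norm_lt_one hw).mul_left 2
  have h2 : HasSum (fun k : ℕ => if k = 0 then (1 : ℂ) else 0) 1 := hasSum_ite_eq 0 1
  have hne : 1 - w ≠ 0 := by
    intro h
    rw [← sub_eq_zero.1 h] at hw
    simp at hw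
  convert! h1.sub h2 using 1
  · funext k
    unfold herglotzCoeff
    split_ifs with hk
    · subst hk; norm_num
    · simp
  · field_simp; ring

/-- The real part is the Poisson kernel `(1 - |w|²) / |1 - w|²`, and `|1 - w| ≤ 2`. The bound
depends on `|w|` only, hence is uniform in the integration variable of the Herglotz integral. -/
lemma le_re_herglotz {w : ℂ} (hw : ‖w‖ < 1) :
    (1 - ‖w‖ ^ 2) / 4 ≤ ((1 + w) / (1 - w)).re := by
  have hne : 1 - w ≠ 0 := by
    intro h
    rw [← sub_eq_zero.1 h] at hw
    simp at hw
  have hn : 0 < Complex.normSq (1 - w) := Complex.normSq_pos.2 hne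
  have h4 : Complex.normSq (1 - w) ≤ 4 := by
    rw [Complex.normSq_eq_norm_sq]
    have : ‖1 - w‖ ≤ 2 := (norm_sub_le _ _).trans (by rw [norm_one]; linarith)
    nlinarith [norm_nonneg (1 - w)]
  have he : ((1 + w) / (1 - w)).re = (1 - ‖w‖ ^ 2) / Complex.normSq (1 - w) := by
    rw [Complex.div_re, ← Complex.normSq_eq_norm_sq, Complex.normSq_apply w]
    simp only [Complex.add_re, Complex.sub_re, Complex.one_re, Complex.add_im, Complex.sub_im,
      Complex.one_im]
    ring
  rw [he]
  have : 0 ≤ 1 - ‖w‖ ^ 2 := by nlinarith [norm_nonneg w]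
  gcongr

/-- The Herglotz integral: its boundary values have real part `f`, for `f` real. -/
lemma hasSum_herglotz_integral {f : UnitAddCircle → ℂ} (hf : Integrable f arc) {z : ℂ}
    (hz : ‖z‖ < 1) :
    HasSum (fun k : ℕ => herglotzCoeff k * fourierCoeff f k * z ^ k)
      (∫ t, (1 + z * fourier (-1) t) / (1 - z * fourier (-1) t) * f t ∂arc) := by
  have hn : ∀ (k : ℤ) (t : UnitAddCircle), ‖fourier k t‖ = 1 := fun k t => by
    rw [fourier_apply, Circle.norm_coe]
  have hpow : ∀ (k : ℕ) (t : UnitAddCircle), (fourier (-1) t : ℂ) ^ k = fourier (-k) t := by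
    intro k t
    induction k with
    | zero => simp
    | succ k ih => rw [pow_succ, ih, ← fourier_add]; push_cast; congr 2; ring
  have hint : ∀ k : ℕ, Integrable
      (fun t => herglotzCoeff k * (z * fourier (-1) t) ^ k * f t) arc := fun k => by
    refine hf.bdd_mul (c := ‖herglotzCoeff k‖ * ‖z‖ ^ k) ?_ ?_
    · exact (Continuous.aestronglyMeasurable (by fun_prop))
    · refine Filter.Eventually.of_forall fun t => ?_
      simp only [norm_mul, norm_pow, hn, mul_one]
      exact le_rfl
  have h := hasSum_integral_of_summable_integral_norm hint ?_
  · convert! h using 1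
    · funext k
      rw [mul_right_comm, fourierCoeff, ← integral_const_mul]
      refine integral_congr_ae (Filter.Eventually.of_forall fun t => ?_)
      simp only [mul_pow, hpow, smul_eq_mul]
      ring
    · refine integral_congr_ae (Filter.Eventually.of_forall fun t => ?_)
      simp only
      have hw : ‖z * fourier (-1) t‖ < 1 := by rw [norm_mul, hn, mul_one]; exact hz
      rw [← (hasSum_herglotz hw).tsum_eq, tsum_mul_right]
  · have : ∀ k : ℕ, ∫ t, ‖herglotzCoeff k * (z * fourier (-1) t) ^ k * f t‖ ∂arc =
        ‖herglotzCoeff k‖ * ‖z‖ ^ k * ∫ t, ‖f t‖ ∂arc := fun k => by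
      rw [← integral_const_mul]
      refine integral_congr_ae (Filter.Eventually.of_forall fun t => ?_)
      simp only [norm_mul, norm_pow, hn, mul_one]
    simp only [this]
    exact (summable_mul_pow norm_herglotzCoeff_le (norm_nonneg z) hz).mul_right _

/-- Strict positivity keeps the Herglotz extension off the branch cut of `w ^ q`, so that its power
is holomorphic. -/
lemma re_herglotz_integral_pos {f : UnitAddCircle → ℂ} (hf : Integrable f arc)
    (h0 : ∀ᵐ t ∂arc, 0 ≤ (f t).re ∧ (f t).im = 0) (hpos : 0 < ∫ t, (f t).re ∂arc) {z : ℂ}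
    (hz : ‖z‖ < 1) :
    0 < (∫ t, (1 + z * fourier (-1) t) / (1 - z * fourier (-1) t) * f t ∂arc).re := by
  have hn : ∀ (t : UnitAddCircle), ‖z * fourier (-1) t‖ = ‖z‖ := fun t => by
    rw [norm_mul, fourier_apply, Circle.norm_coe, mul_one]
  have hne : ∀ t : UnitAddCircle, 1 - z * fourier (-1) t ≠ 0 := fun t h => by
    have h2 := hn t
    rw [← sub_eq_zero.1 h] at h2
    simp at h2
    linarith
  have hk : Continuous fun t : UnitAddCircle =>
      (1 + z * fourier (-1) t) / (1 - z * fourier (-1) t) :=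
    Continuous.div (by fun_prop) (by fun_prop) hne
  obtain ⟨c, hc⟩ := (isCompact_univ.bddAbove_image (f := fun t : UnitAddCircle =>
      ‖(1 + z * fourier (-1) t) / (1 - z * fourier (-1) t)‖) hk.norm.continuousOn)
  have hint : Integrable (fun t => (1 + z * fourier (-1) t) / (1 - z * fourier (-1) t) * f t) arc :=
    hf.bdd_mul hk.aestronglyMeasurable
      (Filter.Eventually.of_forall fun t => hc (Set.mem_image_of_mem _ (Set.mem_univ t)))
  have hre := integral_re hint
  simp only [RCLike.re_eq_complex_re] at hre
  rw [← hre]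
  have hz2 : 0 < (1 - ‖z‖ ^ 2) / 4 := by nlinarith [norm_nonneg z]
  refine (mul_pos hz2 hpos).trans_le ?_
  rw [← integral_const_mul]
  refine integral_mono_ae (hf.re.const_mul _) hint.re ?_
  filter_upwards [h0] with t ht
  have h1 := le_re_herglotz (w := z * fourier (-1) t) (by rw [hn]; exact hz)
  rw [hn] at h1
  simp only [Complex.mul_re, ht.2, mul_zero, sub_zero]
  exact mul_le_mul_of_nonneg_right h1 ht.1

/-- The restriction of `∑ b k z ^ k` to the circle of radius `r`. -/
def dilate (b : ℕ → ℂ) (r : ℝ) : C(UnitAddCircle, ℂ) :=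
  ∑' k : ℕ, (b k * (r : ℂ) ^ k) • fourier (k : ℤ)

lemma hasSum_dilate {b : ℕ → ℂ} {M r : ℝ} (hb : ∀ k, ‖b k‖ ≤ M) (h0 : 0 ≤ r) (hr : r < 1) :
    HasSum (fun k : ℕ => (b k * (r : ℂ) ^ k) • (fourier (k : ℤ) : C(UnitAddCircle, ℂ)))
      (dilate b r) := by
  refine Summable.hasSum (Summable.of_norm ?_)
  refine (summable_mul_pow hb h0 hr).congr fun k => ?_
  rw [norm_smul, fourier_norm, mul_one, norm_mul, norm_pow, Complex.norm_real,
    Real.norm_of_nonneg h0]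

lemma dilate_apply {b : ℕ → ℂ} {M r : ℝ} (hb : ∀ k, ‖b k‖ ≤ M) (h0 : 0 ≤ r) (hr : r < 1)
    (t : UnitAddCircle) : dilate b r t = ∑' k, b k * (r * fourier 1 t) ^ k := by
  have h := ContinuousMap.hasSum_apply (hasSum_dilate hb h0 hr) t
  rw [← h.tsum_eq]
  refine tsum_congr fun k => ?_
  have : (fourier (k : ℤ) t : ℂ) = (fourier 1 t) ^ k := by
    induction k with
    | zero => simp
    | succ k ih => rw [pow_succ, ← ih, ← fourier_add]; push_cast; rfl
  rw [ContinuousMap.smul_apply, this, smul_eq_mul, mul_pow, mul_assoc]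

lemma fourierCoeff_dilate {b : ℕ → ℂ} {M r : ℝ} (hb : ∀ k, ‖b k‖ ≤ M) (h0 : 0 ≤ r)
    (hr : r < 1) (m : ℤ) :
    fourierCoeff (dilate b r) m = if 0 ≤ m then b m.toNat * (r : ℂ) ^ m.toNat else 0 := by
  have h := ((coeffCLM (p := 2) m).comp (ContinuousMap.toLp 2 arc ℂ)).hasSum
    (hasSum_dilate hb h0 hr)
  have e1 : ((coeffCLM (p := 2) m).comp (ContinuousMap.toLp 2 arc ℂ)) (dilate b r) =
      fourierCoeff (dilate b r) m := fourierCoeff_toLp (dilate b r) m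
  rw [e1] at h
  have e2 : ∀ k : ℕ, ((coeffCLM (p := 2) m).comp (ContinuousMap.toLp 2 arc ℂ))
      ((b k * (r : ℂ) ^ k) • fourier (k : ℤ)) = if k = m then b k * (r : ℂ) ^ k else 0 := by
    intro k
    rw [map_smul, smul_eq_mul]
    change _ * fourierCoeff (mono 2 k) m = _
    rw [fourierCoeff_fourierLp]
    by_cases hk : m = k
    · simp [hk]
    · simp [hk, Ne.symm hk]
  simp only [e2] at h
  split_ifs with hm
  · refine h.unique ?_
    lift m to ℕ using hm
    simp only [Int.toNat_natCast, Nat.cast_inj]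
    convert! hasSum_ite_eq m (b m * (r : ℂ) ^ m) using 3 with k
    subst_vars; rfl
  · refine h.unique ?_
    convert! hasSum_zero using 2 with k
    rw [if_neg (by lia)]

lemma norm_sq_eq_tsum (f : LpT 2) : ‖f‖ ^ 2 = ∑' k : ℤ, ‖fourierCoeff f k‖ ^ 2 := by
  rw [tsum_sq_fourierCoeff, ← Complex.ofReal_inj, ← integral_complex_ofReal]
  have h := inner_self_eq_norm_sq_to_K (𝕜 := ℂ) f
  rw [L2.inner_def] at h
  simp only [inner_self_eq_norm_sq_to_K] at h
  push_cast
  exact h.symm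

/-- By Parseval the squared distance is `∑ |r^k - 1|² |F̂(k)|²` over `k ≥ 0`; dominated convergence
applies with majorant `|F̂(k)|²`. -/
lemma tendsto_dilate {b : ℕ → ℂ} {F : LpT 2}
    (hF : ∀ k : ℤ, fourierCoeff F k = if 0 ≤ k then b k.toNat else 0) :
    Filter.Tendsto (fun r : ℝ => ContinuousMap.toLp 2 arc ℂ (dilate b r))
      (nhdsWithin 1 (Set.Ico 0 1)) (nhds F) := by
  have hb : ∀ k, ‖b k‖ ≤ ‖F‖ := fun k => by
    have := norm_fourierCoeff_le F k
    rwa [hF, if_pos (by lia), Int.toNat_natCast] at this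
  rw [tendsto_iff_norm_sub_tendsto_zero]
  have hsq : Filter.Tendsto
      (fun r : ℝ => ‖ContinuousMap.toLp 2 arc ℂ (dilate b r) - F‖ ^ 2)
      (nhdsWithin 1 (Set.Ico 0 1)) (nhds 0) := by
    simp only [norm_sq_eq_tsum]
    suffices h : Filter.Tendsto (fun r : ℝ =>
        ∑' k : ℤ, ‖fourierCoeff (ContinuousMap.toLp 2 arc ℂ (dilate b r) - F : LpT 2) k‖ ^ 2)
        (nhdsWithin 1 (Set.Ico 0 1)) (nhds (∑' k : ℤ, (0 : ℝ))) by
      rwa [tsum_zero] at h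
    refine tendsto_tsum_of_dominated_convergence
      (bound := fun k => ‖fourierCoeff F k‖ ^ 2) (hasSum_sq_fourierCoeff F).summable ?_ ?_
    · intro k
      have : Filter.Tendsto (fun r : ℝ => ‖(r : ℂ) ^ k.toNat - 1‖ ^ 2 * ‖fourierCoeff F k‖ ^ 2)
          (nhdsWithin 1 (Set.Ico 0 1)) (nhds 0) := by
        have hc : Continuous fun r : ℝ => ‖(r : ℂ) ^ k.toNat - 1‖ ^ 2 * ‖fourierCoeff F k‖ ^ 2 := by
          fun_prop
        have := hc.tendsto 1
        simp only [Complex.ofReal_one, one_pow, sub_self, norm_zero] at this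
        exact (by simpa using this : Filter.Tendsto _ _ _).mono_left nhdsWithin_le_nhds
      refine this.congr' ?_
      filter_upwards [self_mem_nhdsWithin] with r hr
      rw [← mul_pow, ← norm_mul, ← coeffCLM_apply k (_ - _), map_sub, coeffCLM_apply,
        coeffCLM_apply, fourierCoeff_toLp, fourierCoeff_dilate hb hr.1 hr.2, hF]
      split_ifs
      · ring_nf
      · simp
    · filter_upwards [self_mem_nhdsWithin] with r hr k
      rw [← coeffCLM_apply k (_ - _), map_sub, coeffCLM_apply,
        coeffCLM_apply, fourierCoeff_toLp, fourierCoeff_dilate hb hr.1 hr.2, hF,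
        Real.norm_of_nonneg (by positivity)]
      split_ifs
      · have : b k.toNat * (r : ℂ) ^ k.toNat - b k.toNat =
            b k.toNat * ((r ^ k.toNat - 1 : ℝ) : ℂ) := by push_cast; ring
        rw [this, norm_mul, Complex.norm_real]
        have h1 : r ^ k.toNat ≤ 1 := pow_le_one₀ hr.1 hr.2.le
        have h2 : 0 ≤ r ^ k.toNat := pow_nonneg hr.1 _
        have h3 : ‖r ^ k.toNat - 1‖ ≤ 1 := by rw [Real.norm_eq_abs, abs_le]; constructor <;> linarith
        gcongr
        exact mul_le_of_le_one_right (norm_nonneg _) h3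
      · simp
  have := hsq.sqrt
  simpa using this

lemma norm_lpIncl_rpow_eq_integral [Fact (1 ≤ q)] (hq1 : q ≠ ∞) (hq : q ≤ 2) (f : LpT 2)
    {g : UnitAddCircle → ℂ} (hg : f =ᵐ[arc] g) :
    ‖lpIncl hq f‖ ^ q.toReal = ∫ t, ‖g t‖ ^ q.toReal ∂arc := by
  have hq0 : q ≠ 0 := (zero_lt_one.trans_le (Fact.out : 1 ≤ q)).ne'
  have hpos := ENNReal.toReal_pos hq0 hq1
  have h := (Lp.memLp (lpIncl hq f)).eLpNorm_eq_integral_rpow_norm hq0 hq1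
  have hint : 0 ≤ ∫ t, ‖lpIncl hq f t‖ ^ q.toReal ∂arc :=
    integral_nonneg fun t => by positivity
  rw [Lp.norm_def, h, ENNReal.toReal_ofReal (by positivity), ← Real.rpow_mul hint,
    inv_mul_cancel₀ hpos.ne', Real.rpow_one]
  refine integral_congr_ae ?_
  filter_upwards [hg] with t ht
  rw [← ht, coeFn_lpIncl]

lemma coeFn_re_part (f : LpT 2) :
    ((1 / 2 : ℂ) • (f + star f) : LpT 2) =ᵐ[arc] fun t => ((f t).re : ℂ) := by
  filter_upwards [Lp.coeFn_smul (1 / 2 : ℂ) (f + star f), Lp.coeFn_add f (star f),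
    Lp.coeFn_star f] with t h1 h2 h3
  rw [h1, Pi.smul_apply, h2, Pi.add_apply, h3, Pi.star_apply]
  apply Complex.ext
  · simp; ring
  · simp

/-- The pointwise inequality is integrated over the circle of radius `r`. By the mean value property
the `B`-term equals `B (∫ f)^Q ≥ 0` and may be discarded. -/
lemma herglotz_rpow_integral_le {Q : ℝ} {A B : ℝ} (hB : 0 ≤ B)
    (hAB : ∀ w : ℂ, 0 < w.re → ‖w‖ ^ Q ≤ A * w.re ^ Q - B * (w ^ (Q : ℂ)).re) (hQ : 0 < Q)
    {f : UnitAddCircle → ℂ} (hf : Integrable f arc)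
    (h0 : ∀ᵐ t ∂arc, 0 ≤ (f t).re ∧ (f t).im = 0) (hpos : 0 < ∫ t, (f t).re ∂arc) {M : ℝ}
    (hM : ∀ k : ℕ, ‖herglotzCoeff k * fourierCoeff f k‖ ≤ M) {r : ℝ} (hr0 : 0 ≤ r) (hr : r < 1) :
    ∫ t, ‖dilate (fun k => herglotzCoeff k * fourierCoeff f k) r t‖ ^ Q ∂arc ≤
      A * ∫ t, ‖((dilate (fun k => herglotzCoeff k * fourierCoeff f k) r t).re : ℂ)‖ ^ Q ∂arc := by
  set b : ℕ → ℂ := fun k => herglotzCoeff k * fourierCoeff f k with hb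
  set Φ : ℂ → ℂ := fun z => ∑' k, b k * z ^ k with hΦ
  have hΦpos : ∀ z : ℂ, ‖z‖ < 1 → 0 < (Φ z).re := fun z hz => by
    have h : Φ z = _ := (hasSum_herglotz_integral hf hz).tsum_eq
    rw [h]
    exact re_herglotz_integral_pos hf h0 hpos hz
  have hdil : ∀ t, dilate b r t = Φ (r * fourier 1 t) := dilate_apply hM hr0 hr
  have hn : ∀ t : UnitAddCircle, ‖(r * fourier 1 t : ℂ)‖ < 1 := fun t => by
    rw [norm_mul, fourier_apply, Circle.norm_coe, mul_one, Complex.norm_real,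
      Real.norm_of_nonneg hr0]
    exact hr
  have hre : ∀ t, 0 < (dilate b r t).re := fun t => by rw [hdil]; exact hΦpos _ (hn t)
  have hmean : ∫ t, (dilate b r t) ^ (Q : ℂ) ∂arc = (Φ 0) ^ (Q : ℂ) := by
    simp only [hdil]
    rw [integral_arc_eq_circleAverage (fun z => Φ z ^ (Q : ℂ)) r]
    -- Any radius strictly between `r` and `1` would do: the closed disc of radius `r` must lie
    -- inside the domain of holomorphy.
    have hd : DifferentiableOn ℂ (fun z => Φ z ^ (Q : ℂ)) (Metric.ball 0 ((1 + r) / 2)) := by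
      refine (differentiableOn_tsum_mul_pow hM (by linarith)).cpow_const fun z hz => ?_
      exact Or.inl (hΦpos z ((mem_ball_zero_iff.1 hz).trans (by linarith)))
    have hcl : closure (Metric.ball (0 : ℂ) |r|) ⊆ Metric.ball 0 ((1 + r) / 2) := by
      refine Metric.closure_ball_subset_closedBall.trans ?_
      refine Metric.closedBall_subset_ball ?_
      rw [abs_of_nonneg hr0]; linarith
    exact (hd.mono hcl).diffContOnCl.circleAverage
  have hΦ0 : Φ 0 = ((∫ t, (f t).re ∂arc : ℝ) : ℂ) := by
    have h1 : Φ 0 = b 0 := by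
      rw [hΦ]
      simp only
      rw [tsum_eq_single 0 fun k hk => by rw [zero_pow hk, mul_zero], pow_zero, mul_one]
    rw [h1, hb, ← integral_complex_ofReal]
    simp only [herglotzCoeff, if_true, one_mul, Nat.cast_zero, fourierCoeff, neg_zero,
      fourier_zero, one_smul]
    refine integral_congr_ae ?_
    filter_upwards [h0] with t ht
    exact Complex.ext rfl ht.2
  have hcont : Continuous fun t => (dilate b r t) ^ (Q : ℂ) := by
    refine continuous_iff_continuousAt.2 fun t => ?_
    exact ((dilate b r).continuous.continuousAt).cpow continuousAt_const (Or.inl (hre t))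
  have hint : Integrable (fun t => (dilate b r t) ^ (Q : ℂ)) arc :=
    hcont.integrable_of_hasCompactSupport (HasCompactSupport.of_compactSpace _)
  have hintre : Integrable (fun t => ((dilate b r t) ^ (Q : ℂ)).re) arc := hint.re
  have hi1 : Integrable (fun t => ‖dilate b r t‖ ^ Q) arc :=
    (Continuous.rpow_const (by fun_prop) fun t => Or.inr hQ.le).integrable_of_hasCompactSupport
      (HasCompactSupport.of_compactSpace _)
  have hi2 : Integrable (fun t => ‖((dilate b r t).re : ℂ)‖ ^ Q) arc :=
    (Continuous.rpow_const (by fun_prop) fun t => Or.inr hQ.le).integrable_of_hasCompactSupport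
      (HasCompactSupport.of_compactSpace _)
  have hB' : 0 ≤ B * ∫ t, ((dilate b r t) ^ (Q : ℂ)).re ∂arc := by
    refine mul_nonneg hB ?_
    have := integral_re hint
    simp only [RCLike.re_eq_complex_re] at this
    rw [this, hmean, hΦ0, ← Complex.ofReal_cpow hpos.le, Complex.ofReal_re]
    positivity
  calc ∫ t, ‖dilate b r t‖ ^ Q ∂arc
      ≤ ∫ t, (A * ‖((dilate b r t).re : ℂ)‖ ^ Q - B * ((dilate b r t) ^ (Q : ℂ)).re) ∂arc := by
        refine integral_mono hi1 ((hi2.const_mul _).sub (hintre.const_mul _)) fun t => ?_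
        simp only
        rw [Complex.norm_real, Real.norm_of_nonneg (hre t).le]
        exact hAB _ (hre t)
    _ = A * ∫ t, ‖((dilate b r t).re : ℂ)‖ ^ Q ∂arc -
          B * ∫ t, ((dilate b r t) ^ (Q : ℂ)).re ∂arc := by
        rw [integral_sub (hi2.const_mul _) (hintre.const_mul _), integral_const_mul,
          integral_const_mul]
    _ ≤ _ := by linarith

/-- The inequality of M. Riesz for nonnegative functions. -/
lemma exists_riesz_bound_nonneg [Fact (1 ≤ q)] (hq1 : 1 < q) (hq : q ≤ 2) :
    ∃ C : ℝ, ∀ f g : LpT 2, (∀ᵐ t ∂arc, 0 ≤ (f t).re ∧ (f t).im = 0) → g ∈ hardy 2 →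
      f - g ∈ conjHardyZero 2 → ‖lpIncl hq g‖ ≤ C * ‖lpIncl hq f‖ := by
  have hqt : q ≠ ∞ := ne_top_of_le_ne_top ENNReal.ofNat_ne_top hq
  have hQ1 : 1 < q.toReal := by
    rw [← ENNReal.toReal_one]; exact (ENNReal.toReal_lt_toReal ENNReal.one_ne_top hqt).2 hq1
  have hQ2 : q.toReal ≤ 2 := by
    have := ENNReal.toReal_mono ENNReal.ofNat_ne_top hq
    simpa using this
  set Q := q.toReal with hQ
  have hQ0 : 0 < Q := by linarith
  obtain ⟨A, B, hA, hB, hAB⟩ := exists_rpow_norm_le hQ1 hQ2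
  -- The constant comes from `g = (F + c) / 2` with `‖F‖ ≤ A^{1/Q} ‖f‖` and `|c| ≤ ‖f‖`, norms taken
  -- in `L^q`.
  refine ⟨(A ^ (1 / Q) + 1) / 2, fun f g hf hg hfg => ?_⟩
  have hint : Integrable f arc := (Lp.memLp f).integrable one_le_two
  have hnn : 0 ≤ ∫ t, (f t).re ∂arc := integral_nonneg_of_ae (hf.mono fun t ht => ht.1)
  -- If `∫ f = 0` the extension vanishes and its real part is not strictly positive, but then `f =
  -- 0` and `g = 0`.
  rcases hnn.eq_or_lt with hz | hpos
  · have hf0 : f = 0 := by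
      rw [Lp.eq_zero_iff_ae_eq_zero]
      have h := (integral_eq_zero_iff_of_nonneg_ae (hf.mono fun t ht => ht.1) hint.re).1 hz.symm
      filter_upwards [h, hf] with t h1 h2
      exact Complex.ext h1 h2.2
    have hg0 : g = 0 := by
      subst hf0
      rw [zero_sub, mem_conjHardyZero_iff] at hfg
      refine ext_fourierCoeff ENNReal.one_lt_two fun k => ?_
      have h2 : fourierCoeff (0 : LpT 2) k = 0 := (coeffCLM (p := 2) k).map_zero
      rw [h2]
      rcases lt_or_ge k 0 with hk | hk
      · exact hg k hk
      · have := hfg k hk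
        rwa [← coeffCLM_apply, map_neg, neg_eq_zero] at this
    rw [hf0, hg0]
    simp [← lpInclL_apply]
  set b : ℕ → ℂ := fun k => herglotzCoeff k * fourierCoeff f k with hb
  have hgf : ∀ k : ℤ, 0 ≤ k → fourierCoeff g k = fourierCoeff f k := fun k hk => by
    have := mem_conjHardyZero_iff.1 hfg k hk
    rw [← coeffCLM_apply, map_sub, sub_eq_zero] at this
    exact this.symm
  set c := fourierCoeff f 0 with hc
  -- `F` is the boundary function of the Herglotz integral of `f`: its coefficients are
  -- `herglotzCoeff k` times those of `f`, and its real part is `f`.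
  set F : LpT 2 := (2 : ℂ) • g - c • mono 2 0 with hFdef
  have hFk : ∀ k : ℤ, fourierCoeff F k = 2 * fourierCoeff g k - if k = 0 then c else 0 := by
    intro k
    rw [← coeffCLM_apply, hFdef, map_sub, map_smul, map_smul, coeffCLM_apply, coeffCLM_apply,
      fourierCoeff_fourierLp]
    simp
  have hF : ∀ k : ℤ, fourierCoeff F k = if 0 ≤ k then b k.toNat else 0 := by
    intro k
    rw [hFk]
    split_ifs with h1 h2 h2
    · subst h1
      rw [hgf 0 le_rfl, hb]
      simp [herglotzCoeff, hc]; ring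
    · exact absurd h1 (by lia)
    · lift k to ℕ using h2
      rw [hgf k (by lia), hb]
      have : k ≠ 0 := by exact_mod_cast h1
      simp [herglotzCoeff, this]
    · rw [hg k (by lia)]; simp
  have hM : ∀ k, ‖b k‖ ≤ ‖F‖ := fun k => by
    have := norm_fourierCoeff_le F k
    rwa [hF, if_pos (by lia), Int.toNat_natCast] at this
  have hstarf : star f = f := by
    apply Lp.ext
    filter_upwards [Lp.coeFn_star f, hf] with t h1 h2
    rw [h1, Pi.star_apply]
    exact Complex.conj_eq_iff_im.2 h2.2
  have hfc : ∀ k, fourierCoeff f k = star (fourierCoeff f (-k)) := fun k => by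
    conv_lhs => rw [← hstarf]
    exact fourierCoeff_star f k
  have hReF : (1 / 2 : ℂ) • (F + star F) = f := by
    refine ext_fourierCoeff ENNReal.one_lt_two fun k => ?_
    rw [← coeffCLM_apply, map_smul, map_add, coeffCLM_apply, coeffCLM_apply, fourierCoeff_star,
      hFk, hFk, smul_eq_mul]
    rcases lt_trichotomy k 0 with hk | hk | hk
    · rw [hg k hk, hgf (-k) (by lia), if_neg hk.ne, if_neg (by lia), hfc k]
      simp
    · subst hk
      have h00 := hfc 0
      rw [neg_zero] at h00 ⊢
      rw [if_pos rfl, hgf 0 le_rfl, hc, star_sub, star_mul, ← h00]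
      simp; ring
    · rw [hg (-k) (by lia), hgf k hk.le, if_neg hk.ne', if_neg (by lia)]
      simp
  have hlim := tendsto_dilate hF
  have hcont : Continuous fun G : LpT 2 => ‖lpIncl hq G‖ ^ Q :=
    ((lpInclL hq).continuous.norm).rpow_const fun _ => Or.inr hQ0.le
  have hcont2 : Continuous fun G : LpT 2 => A * ‖lpIncl hq ((1 / 2 : ℂ) • (G + star G))‖ ^ Q :=
    continuous_const.mul (hcont.comp
      ((continuous_id.add continuous_star').const_smul (1 / 2 : ℂ)))
  have hne : (nhdsWithin (1 : ℝ) (Set.Ico 0 1)).NeBot := by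
    rw [← mem_closure_iff_nhdsWithin_neBot, closure_Ico zero_ne_one]
    exact Set.right_mem_Icc.2 zero_le_one
  have key : ‖lpIncl hq F‖ ^ Q ≤ A * ‖lpIncl hq ((1 / 2 : ℂ) • (F + star F))‖ ^ Q := by
    -- Both sides are continuous in the `L^2` norm, so the inequality passes from the dilates to `F`
    -- as `r → 1`.
    refine le_of_tendsto_of_tendsto ((hcont.tendsto F).comp hlim)
      ((hcont2.tendsto F).comp hlim) ?_
    filter_upwards [self_mem_nhdsWithin] with r hr
    have hco := ContinuousMap.coeFn_toLp (p := 2) (𝕜 := ℂ) arc (dilate b r)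
    simp only [Function.comp_apply]
    rw [norm_lpIncl_rpow_eq_integral hqt hq _ hco, norm_lpIncl_rpow_eq_integral hqt hq
      (g := fun t => ((dilate b r t).re : ℂ))]
    · exact herglotz_rpow_integral_le hB hAB hQ0 hint hf hpos hM hr.1 hr.2
    · filter_upwards [coeFn_re_part (ContinuousMap.toLp 2 arc ℂ (dilate b r)), hco] with t h1 h2
      rw [h1, h2]
  rw [hReF] at key
  have key2 : ‖lpIncl hq F‖ ≤ A ^ (1 / Q) * ‖lpIncl hq f‖ := by
    have := Real.rpow_le_rpow (by positivity) key (show 0 ≤ 1 / Q by positivity)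
    rwa [Real.mul_rpow hA (by positivity), ← Real.rpow_mul (norm_nonneg _),
      ← Real.rpow_mul (norm_nonneg _), mul_one_div_cancel hQ0.ne', Real.rpow_one,
      Real.rpow_one] at this
  have hgF : g = (1 / 2 : ℂ) • (F + c • mono 2 0) := by
    rw [hFdef, sub_add_cancel, smul_smul]; norm_num
  have hmono : ‖lpIncl hq (mono 2 0)‖ ≤ 1 :=
    (norm_lpIncl_le hq _).trans_eq (orthonormal_fourier.1 0)
  have hcf : ‖c‖ ≤ ‖lpIncl hq f‖ := norm_fourierCoeff_le (lpIncl hq f) 0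
  have hgn : ‖lpIncl hq g‖ ≤ 1 / 2 * (‖lpIncl hq F‖ + ‖c‖) := by
    rw [← lpInclL_apply, hgF, map_smul, map_add, map_smul, norm_smul]
    have : ‖(1 / 2 : ℂ)‖ = 1 / 2 := by norm_num
    rw [this]
    refine mul_le_mul_of_nonneg_left ((norm_add_le _ _).trans ?_) (by norm_num)
    rw [norm_smul]
    exact add_le_add le_rfl (mul_le_of_le_one_right (norm_nonneg _) hmono)
  calc _ ≤ _ := hgn
    _ ≤ 1 / 2 * (A ^ (1 / Q) * ‖lpIncl hq f‖ + ‖lpIncl hq f‖) := by gcongr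
    _ = _ := by ring

/-! ### The Riesz projection on `L^2` and its extension to `L^q` -/

instance : CompleteSpace (hardy 2) := isClosed_hardy.completeSpace_coe

/-- The orthogonal projection of `L^2` onto `H^2`. -/
abbrev rieszTwo : LpT 2 →L[ℂ] LpT 2 := (hardy 2).starProjection

lemma rieszTwo_mem (f : LpT 2) : rieszTwo f ∈ hardy 2 := Submodule.starProjection_apply_mem _ _

lemma sub_rieszTwo_mem (f : LpT 2) : f - rieszTwo f ∈ conjHardyZero 2 := by
  rw [mem_conjHardyZero_iff]
  intro k hk
  have h1 : mono 2 k ∈ hardy 2 := fun m hm => by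
    rw [fourierCoeff_fourierLp, if_neg (by lia)]
  have h2 := Submodule.inner_right_of_mem_orthogonal h1
    (Submodule.sub_starProjection_mem_orthogonal (K := hardy 2) f)
  rw [← h2, ← fourierBasis_repr, HilbertBasis.repr_apply_apply, coe_fourierBasis]

/-- Applied to the positive and negative parts of the real and imaginary parts, to reduce the Riesz
bound to nonnegative functions. -/
lemma exists_nonneg_comp (hq : q ≤ 2) (f : LpT 2) {φ : ℂ → ℝ} (hφ : Continuous φ)
    (h0 : ∀ z, 0 ≤ φ z) (h1 : ∀ z, φ z ≤ ‖z‖) :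
    ∃ g : LpT 2, (g =ᵐ[arc] fun t => (φ (f t) : ℂ)) ∧
      (∀ᵐ t ∂arc, 0 ≤ (g t).re ∧ (g t).im = 0) ∧ ‖lpIncl hq g‖ ≤ ‖lpIncl hq f‖ := by
  have hn : ∀ z, ‖(φ z : ℂ)‖ ≤ ‖z‖ := fun z => by
    rw [Complex.norm_real, Real.norm_of_nonneg (h0 z)]; exact h1 z
  have hm : MemLp (fun t => (φ (f t) : ℂ)) 2 arc :=
    (Lp.memLp f).of_le ((Complex.continuous_ofReal.comp hφ).comp_aestronglyMeasurable
      (Lp.aestronglyMeasurable f)) (Filter.Eventually.of_forall fun t => hn _)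
  refine ⟨hm.toLp _, hm.coeFn_toLp, ?_, Lp.norm_le_norm_of_ae_le ?_⟩
  · filter_upwards [hm.coeFn_toLp] with t ht
    rw [ht]
    exact ⟨h0 _, rfl⟩
  · filter_upwards [hm.coeFn_toLp] with t ht
    rw [coeFn_lpIncl, coeFn_lpIncl, ht]
    exact hn _

lemma exists_riesz_bound [Fact (1 ≤ q)] (hq1 : 1 < q) (hq : q ≤ 2) :
    ∃ C : ℝ, ∀ f : LpT 2, ‖lpIncl hq (rieszTwo f)‖ ≤ C * ‖lpIncl hq f‖ := by
  obtain ⟨C, hC⟩ := exists_riesz_bound_nonneg hq1 hq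
  refine ⟨4 * |C|, fun f => ?_⟩
  have hb : ∀ u : LpT 2, (∀ᵐ t ∂arc, 0 ≤ (u t).re ∧ (u t).im = 0) →
      ‖lpIncl hq u‖ ≤ ‖lpIncl hq f‖ → ‖lpIncl hq (rieszTwo u)‖ ≤ |C| * ‖lpIncl hq f‖ :=
    fun u hu hn => (hC u _ hu (rieszTwo_mem u) (sub_rieszTwo_mem u)).trans <|
      mul_le_mul (le_abs_self C) hn (norm_nonneg _) (abs_nonneg C)
  obtain ⟨f₁, e1, h1, n1⟩ := exists_nonneg_comp hq f (φ := fun z => max z.re 0) (by fun_prop)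
    (fun z => le_max_right _ _)
    fun z => max_le ((le_abs_self _).trans (Complex.abs_re_le_norm z)) (norm_nonneg z)
  obtain ⟨f₂, e2, h2, n2⟩ := exists_nonneg_comp hq f (φ := fun z => max (-z.re) 0) (by fun_prop)
    (fun z => le_max_right _ _)
    fun z => max_le ((neg_le_abs _).trans (Complex.abs_re_le_norm z)) (norm_nonneg z)
  obtain ⟨f₃, e3, h3, n3⟩ := exists_nonneg_comp hq f (φ := fun z => max z.im 0) (by fun_prop)
    (fun z => le_max_right _ _)
    fun z => max_le ((le_abs_self _).trans (Complex.abs_im_le_norm z)) (norm_nonneg z)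
  obtain ⟨f₄, e4, h4, n4⟩ := exists_nonneg_comp hq f (φ := fun z => max (-z.im) 0) (by fun_prop)
    (fun z => le_max_right _ _)
    fun z => max_le ((neg_le_abs _).trans (Complex.abs_im_le_norm z)) (norm_nonneg z)
  have hmax : ∀ x : ℝ, max x 0 - max (-x) 0 = x := fun x => by
    rcases le_total x 0 with h | h
    · rw [max_eq_right h, max_eq_left (by linarith)]; ring
    · rw [max_eq_left h, max_eq_right (by linarith)]; ring
  have hf : f = (f₁ - f₂) + Complex.I • (f₃ - f₄) := by
    apply Lp.ext
    filter_upwards [Lp.coeFn_add (f₁ - f₂) (Complex.I • (f₃ - f₄)), Lp.coeFn_sub f₁ f₂,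
      Lp.coeFn_sub f₃ f₄, Lp.coeFn_smul Complex.I (f₃ - f₄), e1, e2, e3, e4]
      with t a1 a2 a3 a4 a5 a6 a7 a8
    rw [a1, Pi.add_apply, a2, a4, Pi.smul_apply, Pi.sub_apply, a3, Pi.sub_apply, a5, a6, a7, a8,
      ← Complex.ofReal_sub, ← Complex.ofReal_sub, hmax, hmax, smul_eq_mul, mul_comm]
    exact (Complex.re_add_im _).symm
  have hdec : lpIncl hq (rieszTwo f) = (lpIncl hq (rieszTwo f₁) - lpIncl hq (rieszTwo f₂)) +
      Complex.I • (lpIncl hq (rieszTwo f₃) - lpIncl hq (rieszTwo f₄)) := by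
    have : ∀ u, lpIncl hq (rieszTwo u) = (lpInclL hq).comp rieszTwo u := fun u => rfl
    rw [this, this, this, this, this]
    conv_lhs => rw [hf]
    rw [map_add, map_sub, map_smul, map_sub]
  rw [hdec]
  calc _ ≤ (‖lpIncl hq (rieszTwo f₁)‖ + ‖lpIncl hq (rieszTwo f₂)‖) +
        (‖lpIncl hq (rieszTwo f₃)‖ + ‖lpIncl hq (rieszTwo f₄)‖) := by
        refine (norm_add_le _ _).trans (add_le_add (norm_sub_le _ _) ?_)
        rw [norm_smul, Complex.norm_I, one_mul]
        exact norm_sub_le _ _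
    _ ≤ (|C| * ‖lpIncl hq f‖ + |C| * ‖lpIncl hq f‖) +
        (|C| * ‖lpIncl hq f‖ + |C| * ‖lpIncl hq f‖) :=
        add_le_add (add_le_add (hb _ h1 n1) (hb _ h2 n2)) (add_le_add (hb _ h3 n3) (hb _ h4 n4))
    _ = _ := by ring

lemma denseRange_lpInclL [Fact (1 ≤ q)] (hq : q ≤ 2) :
    DenseRange (lpInclL hq : LpT 2 →L[ℂ] LpT q) := by
  have hqt : q ≠ ∞ := ne_top_of_le_ne_top ENNReal.ofNat_ne_top hq
  have h : (Submodule.span ℂ (Set.range (mono q))) ≤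
      LinearMap.range (lpInclL hq : LpT 2 →L[ℂ] LpT q).toLinearMap := by
    rw [Submodule.span_le]
    rintro _ ⟨k, rfl⟩
    refine ⟨mono 2 k, ?_⟩
    apply Lp.ext
    have h1 := coeFn_fourierLp (T := (1 : ℝ)) 2 k
    have h2 := coeFn_fourierLp (T := (1 : ℝ)) q k
    exact h1.trans h2.symm
  have hd : Dense (Submodule.span ℂ (Set.range (mono q)) : Set (LpT q)) := by
    rw [dense_iff_closure_eq, ← Submodule.topologicalClosure_coe,
      span_fourierLp_closure_eq_top hqt]
    rfl
  exact hd.mono h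

/-- The Riesz projection of `L^q` onto `H^q` as a bounded operator, for `1 < q ≤ 2`. -/
def rieszL [Fact (1 ≤ q)] (hq : q ≤ 2) : LpT q →L[ℂ] LpT q :=
  ((lpInclL hq).comp rieszTwo).toLinearMap.extendOfNorm (lpInclL hq).toLinearMap

/-- The Riesz bound is what makes the extension by density agree with `rieszTwo` on `L^2`. -/
lemma rieszL_lpIncl [Fact (1 ≤ q)] (hq1 : 1 < q) (hq : q ≤ 2) (f : LpT 2) :
    rieszL hq (lpIncl hq f) = lpIncl hq (rieszTwo f) :=
  LinearMap.extendOfNorm_eq (f := ((lpInclL hq).comp rieszTwo).toLinearMap)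
    (e := (lpInclL hq).toLinearMap) (denseRange_lpInclL hq) (exists_riesz_bound hq1 hq) f

lemma rieszL_mem [Fact (1 ≤ q)] (hq1 : 1 < q) (hq : q ≤ 2) (f : LpT q) :
    rieszL hq f ∈ hardy q := by
  refine (denseRange_lpInclL hq).induction_on (p := fun f => rieszL hq f ∈ hardy q) f
    (isClosed_hardy'.preimage (rieszL hq).continuous) fun g => ?_
  rw [lpInclL_apply, rieszL_lpIncl hq1 hq]
  exact rieszTwo_mem g

lemma sub_rieszL_mem [Fact (1 ≤ q)] (hq1 : 1 < q) (hq : q ≤ 2) (f : LpT q) :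
    f - rieszL hq f ∈ conjHardyZero q := by
  refine (denseRange_lpInclL hq).induction_on
    (p := fun f => f - rieszL hq f ∈ conjHardyZero q) f
    (isClosed_conjHardyZero'.preimage (continuous_id.sub (rieszL hq).continuous)) fun g => ?_
  rw [lpInclL_apply, rieszL_lpIncl hq1 hq]
  exact (lpIncl_mem_conjHardyZero hq).2 (sub_rieszTwo_mem g)

lemma eq_zero_of_mem_hardy_of_mem_conjHardyZero [Fact (1 ≤ q)] (hq1 : 1 < q) {f : LpT q}
    (h1 : f ∈ hardy q) (h2 : f ∈ conjHardyZero q) : f = 0 := by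
  refine eq_zero_of_fourierCoeff_eq_zero hq1 fun k => ?_
  rcases lt_or_ge k 0 with hk | hk
  · exact h1 k hk
  · exact mem_conjHardyZero_iff.1 h2 k hk

lemma riesz_unique [Fact (1 ≤ q)] (hq1 : 1 < q) {f g g' : LpT q} (hg : g ∈ hardy q)
    (hfg : f - g ∈ conjHardyZero q) (hg' : g' ∈ hardy q) (hfg' : f - g' ∈ conjHardyZero q) :
    g = g' := by
  rw [← sub_eq_zero]
  refine eq_zero_of_mem_hardy_of_mem_conjHardyZero hq1 (sub_mem hg hg') ?_
  have := sub_mem hfg' hfg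
  rwa [sub_sub_sub_cancel_left] at this

/-- The choice inside `rieszPlus` is harmless: two splittings differ by an element of `hardy q ⊓
conjHardyZero q`, which is zero. -/
lemma rieszPlus_eq_of [Fact (1 ≤ q)] (hq1 : 1 < q) {f g : LpT q} (hg : g ∈ hardy q)
    (hfg : f - g ∈ conjHardyZero q) : rieszPlus f = g := by
  have h : ∃ g ∈ hardy q, f - g ∈ conjHardyZero q := ⟨g, hg, hfg⟩
  rw [rieszPlus, dif_pos h]
  exact riesz_unique hq1 h.choose_spec.1 h.choose_spec.2 hg hfg

lemma rieszPlus_eq_rieszL [Fact (1 ≤ q)] (hq1 : 1 < q) (hq : q ≤ 2) (f : LpT q) :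
    rieszPlus f = rieszL hq f :=
  rieszPlus_eq_of hq1 (rieszL_mem hq1 hq f) (sub_rieszL_mem hq1 hq f)

lemma rieszL_of_mem_hardy [Fact (1 ≤ q)] (hq1 : 1 < q) (hq : q ≤ 2) {f : LpT q}
    (hf : f ∈ hardy q) : rieszL hq f = f :=
  riesz_unique hq1 (rieszL_mem hq1 hq f) (sub_rieszL_mem hq1 hq f) hf
    (by rw [sub_self]; exact zero_mem _)

lemma rieszL_of_mem_conjHardyZero [Fact (1 ≤ q)] (hq1 : 1 < q) (hq : q ≤ 2) {f : LpT q}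
    (hf : f ∈ conjHardyZero q) : rieszL hq f = 0 :=
  riesz_unique hq1 (rieszL_mem hq1 hq f) (sub_rieszL_mem hq1 hq f) (zero_mem _)
    (by rwa [sub_zero])

/-! ### Analytic multipliers and the projection `P_{Θ,q}` -/

lemma lpMul_lpIncl (h : q ≤ p) (g : LpT ∞) (f : LpT p) :
    (lpMul g (lpIncl h f) : LpT q) = lpIncl h (lpMul g f : LpT p) := by
  apply Lp.ext
  filter_upwards [lpMul_coeFn (s := q) g (lpIncl h f), lpMul_coeFn (s := p) g f] with t h1 h2
  rw [h1, coeFn_lpIncl, coeFn_lpIncl, h2]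

/-- The convolution argument needs an `L^2` factor. Writing `f` as its own Riesz projection lets `f`
be approximated by `L^2` functions whose projections stay in `H^2`. -/
lemma lpMul_mem_hardy [Fact (1 ≤ q)] (hq1 : 1 < q) (hq : q ≤ 2) {g : LpT ∞} {f : LpT q}
    (hg : g ∈ hardy ∞) (hf : f ∈ hardy q) : (lpMul g f : LpT q) ∈ hardy q := by
  rw [← rieszL_of_mem_hardy hq1 hq hf]
  refine (denseRange_lpInclL hq).induction_on
    (p := fun f => (lpMul g (rieszL hq f) : LpT q) ∈ hardy q) f
    (isClosed_hardy'.preimage ((continuous_lpMul g).comp (rieszL hq).continuous)) fun u => ?_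
  rw [lpInclL_apply, rieszL_lpIncl hq1 hq, lpMul_lpIncl]
  exact lpMul_mem_hardy_two hg (rieszTwo_mem u)

lemma lpMul_mem_conjHardyZero [Fact (1 ≤ q)] (hq1 : 1 < q) (hq : q ≤ 2) {g : LpT ∞} {f : LpT q}
    (hg : g ∈ hardy ∞) (hf : f ∈ conjHardyZero q) :
    (lpMul (star g) f : LpT q) ∈ conjHardyZero q := by
  have h : f - rieszL hq f = f := by rw [rieszL_of_mem_conjHardyZero hq1 hq hf, sub_zero]
  rw [← h]
  refine (denseRange_lpInclL hq).induction_on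
    (p := fun f => (lpMul (star g) (f - rieszL hq f) : LpT q) ∈ conjHardyZero q) f
    (isClosed_conjHardyZero'.preimage ((continuous_lpMul (star g)).comp
      (continuous_id.sub (rieszL hq).continuous))) fun u => ?_
  rw [lpInclL_apply, rieszL_lpIncl hq1 hq]
  have e : lpIncl hq u - lpIncl hq (rieszTwo u) = lpIncl hq (u - rieszTwo u) := rfl
  rw [e, lpMul_lpIncl]
  exact (lpIncl_mem_conjHardyZero hq).2 (lpMul_mem_conjHardyZero_two hg (sub_rieszTwo_mem u))

/-- A bounded operator on `L^q`, acting in each entry of a column. -/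
def vecMapL [Fact (1 ≤ p)] [Fact (1 ≤ q)] (T : LpT p →L[ℂ] LpT q) :
    LpVec n p →L[ℂ] LpVec n q where
  toFun f := WithLp.toLp 2 fun i => T (f i)
  map_add' f g := PiLp.ext fun i => map_add T (f i) (g i)
  map_smul' c f := PiLp.ext fun i => map_smul T c (f i)
  cont := (PiLp.continuous_toLp 2 _).comp
    (continuous_pi fun i => T.continuous.comp (PiLp.continuous_apply 2 _ i))

@[simp] lemma vecMapL_apply [Fact (1 ≤ p)] [Fact (1 ≤ q)] (T : LpT p →L[ℂ] LpT q)
    (f : LpVec n p) (i : Fin n) : vecMapL T f i = T (f i) := rfl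

lemma vecIncl_eq_vecMapL [Fact (1 ≤ p)] [Fact (1 ≤ q)] (h : q ≤ p) (f : LpVec n p) :
    vecIncl h f = vecMapL (lpInclL h) f := rfl

lemma vecIncl_injective (h : q ≤ p) : Function.Injective (vecIncl h : LpVec n p → LpVec n q) := by
  intro f g hfg
  exact PiLp.ext fun i => lpIncl_injective h (congrArg (fun x : LpVec n q => x i) hfg)

/-- Multiplication by a matrix as a bounded operator. -/
def mulVecL [ENNReal.HolderTriple p r q] [Fact (1 ≤ r)] [Fact (1 ≤ q)] (G : LpMat n p) :
    LpVec n r →L[ℂ] LpVec n q := ⟨mulVec G, continuous_mulVec G⟩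

lemma mulVec_apply [ENNReal.HolderTriple p r q] (G : LpMat n p) (f : LpVec n r) (i : Fin n) :
    (mulVec G f : LpVec n q) i = ∑ j, (lpMul (G i j) (f j) : LpT q) := rfl

lemma adj_mulVec_mulVec (Θ : InnerFn n) (f : LpVec n q) :
    (mulVec (adj Θ.toMat) (mulVec Θ.toMat f : LpVec n q) : LpVec n q) = f := by
  refine mulVec_mulVec_eq _ _ ?_ f
  filter_upwards [adj_apply Θ.toMat, Θ.unitary] with z h h'
  rw [h]
  exact h'.1

lemma mulVec_adj_mulVec (Θ : InnerFn n) (f : LpVec n q) :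
    (mulVec Θ.toMat (mulVec (adj Θ.toMat) f : LpVec n q) : LpVec n q) = f := by
  refine mulVec_mulVec_eq _ _ ?_ f
  filter_upwards [adj_apply Θ.toMat, Θ.unitary] with z h h'
  rw [h]
  exact h'.2

lemma mem_modelSpace_iff [Fact (1 ≤ q)] (Θ : InnerFn n) {f : LpVec n q} :
    f ∈ modelSpace Θ q ↔ (∀ i, f i ∈ hardy q) ∧
      ∀ i, (mulVec (adj Θ.toMat) f : LpVec n q) i ∈ conjHardyZero q := by
  constructor
  · rintro ⟨hf, g, hg, rfl⟩
    exact ⟨hf, by rw [adj_mulVec_mulVec]; exact hg⟩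
  · rintro ⟨hf, hg⟩
    exact ⟨hf, _, hg, (mulVec_adj_mulVec Θ f).symm⟩

lemma mulVec_mem_hardy [Fact (1 ≤ q)] (hq1 : 1 < q) (hq : q ≤ 2) (Θ : InnerFn n)
    {f : LpVec n q} (hf : ∀ i, f i ∈ hardy q) (i : Fin n) :
    (mulVec Θ.toMat f : LpVec n q) i ∈ hardy q := by
  rw [mulVec_apply]
  exact Submodule.sum_mem _ fun j _ => lpMul_mem_hardy hq1 hq (Θ.analytic i j) (hf j)

lemma adj_mulVec_mem_conjHardyZero [Fact (1 ≤ q)] (hq1 : 1 < q) (hq : q ≤ 2) (Θ : InnerFn n)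
    {f : LpVec n q} (hf : ∀ i, f i ∈ conjHardyZero q) (i : Fin n) :
    (mulVec (adj Θ.toMat) f : LpVec n q) i ∈ conjHardyZero q := by
  rw [mulVec_apply]
  exact Submodule.sum_mem _ fun j _ => lpMul_mem_conjHardyZero hq1 hq (Θ.analytic j i) (hf j)

/-- The Riesz projection on columns. -/
abbrev rieszVecL (n : ℕ) [Fact (1 ≤ q)] (hq : q ≤ 2) : LpVec n q →L[ℂ] LpVec n q :=
  vecMapL (rieszL hq)

lemma rieszPlusVec_eq [Fact (1 ≤ q)] (hq1 : 1 < q) (hq : q ≤ 2) (f : LpVec n q) :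
    rieszPlusVec f = rieszVecL n hq f :=
  PiLp.ext fun i => rieszPlus_eq_rieszL hq1 hq (f i)

/-- `P_{Θ,q}` as a bounded operator. -/
def modelProjL [Fact (1 ≤ q)] (hq : q ≤ 2) (Θ : InnerFn n) : LpVec n q →L[ℂ] LpVec n q :=
  (rieszVecL n hq).comp ((mulVecL Θ.toMat).comp
    ((ContinuousLinearMap.id ℂ _ - rieszVecL n hq).comp (mulVecL (adj Θ.toMat))))

lemma modelProj_eq_modelProjL [Fact (1 ≤ q)] (hq1 : 1 < q) (hq : q ≤ 2) (Θ : InnerFn n)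
    (f : LpVec n q) : modelProj Θ f = modelProjL hq Θ f := by
  rw [modelProj, rieszMinusVec, rieszPlusVec_eq hq1 hq, rieszPlusVec_eq hq1 hq]
  rfl

/-- `Θ P_- Θ^* f = f - Θ P_+ Θ^* f`, because `Θ Θ^* = I`. -/
lemma modelProjL_apply [Fact (1 ≤ q)] (hq : q ≤ 2) (Θ : InnerFn n) (f : LpVec n q) :
    modelProjL hq Θ f = rieszVecL n hq (f - mulVec Θ.toMat
      (rieszVecL n hq (mulVec (adj Θ.toMat) f : LpVec n q)) : LpVec n q) := by
  change rieszVecL n hq (mulVec Θ.toMat ((mulVec (adj Θ.toMat) f : LpVec n q) -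
    rieszVecL n hq (mulVec (adj Θ.toMat) f : LpVec n q))) = _
  rw [map_sub, mulVec_adj_mulVec]

lemma modelProjL_mem [Fact (1 ≤ q)] (hq1 : 1 < q) (hq : q ≤ 2) (Θ : InnerFn n)
    (f : LpVec n q) : modelProjL hq Θ f ∈ modelSpace Θ q := by
  rw [mem_modelSpace_iff]
  refine ⟨fun i => rieszL_mem hq1 hq _, fun i => ?_⟩
  set h : LpVec n q := mulVec (adj Θ.toMat) f with hh
  set y : LpVec n q := f - mulVec Θ.toMat (rieszVecL n hq h) with hy
  -- Here `Θ^* y = h - P_+ h`. Both terms on the right lie in `conjHardyZero q`, the second because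
  -- multiplication by `Θ^*` preserves that space.
  have e : (mulVec (adj Θ.toMat) (modelProjL hq Θ f) : LpVec n q) =
      (h - rieszVecL n hq h) - mulVec (adj Θ.toMat) (y - rieszVecL n hq y) := by
    rw [modelProjL_apply, map_sub (mulVec _) y, hy, map_sub (mulVec (adj Θ.toMat)) f,
      adj_mulVec_mulVec, ← hh]
    abel
  rw [e]
  exact sub_mem (sub_rieszL_mem hq1 hq _)
    (adj_mulVec_mem_conjHardyZero hq1 hq Θ (fun j => sub_rieszL_mem hq1 hq _) i)

lemma mulVec_vecIncl (h : q ≤ p) (M : LpMat n ∞) (f : LpVec n p) :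
    (mulVec M (vecIncl h f) : LpVec n q) = vecIncl h (mulVec M f : LpVec n p) := by
  refine PiLp.ext fun i => Lp.ext ?_
  refine (coeFn_mulVec M (vecIncl h f) i).trans ?_
  exact (coeFn_mulVec (s := p) M f i).symm

lemma rieszL_lpIncl' [Fact (1 ≤ q)] (hq1 : 1 < q) (hq : q ≤ 2) (f : LpT 2) :
    rieszL hq (lpIncl hq f) = lpIncl hq (rieszL le_rfl f) := by
  refine riesz_unique hq1 (rieszL_mem hq1 hq _) (sub_rieszL_mem hq1 hq _)
    (rieszL_mem ENNReal.one_lt_two le_rfl f) ?_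
  exact (lpIncl_mem_conjHardyZero hq).2 (sub_rieszL_mem ENNReal.one_lt_two le_rfl f)

lemma rieszVecL_vecIncl [Fact (1 ≤ q)] (hq1 : 1 < q) (hq : q ≤ 2) (f : LpVec n 2) :
    rieszVecL n hq (vecIncl hq f) = vecIncl hq (rieszVecL n le_rfl f) :=
  PiLp.ext fun i => rieszL_lpIncl' hq1 hq (f i)

lemma modelProjL_vecIncl [Fact (1 ≤ q)] (hq1 : 1 < q) (hq : q ≤ 2) (Θ : InnerFn n)
    (f : LpVec n 2) : modelProjL hq Θ (vecIncl hq f) = vecIncl hq (modelProjL le_rfl Θ f) := by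
  have hsub : ∀ u v : LpVec n 2, vecIncl hq u - vecIncl hq v = vecIncl hq (u - v) :=
    fun _ _ => rfl
  rw [modelProjL_apply, modelProjL_apply, mulVec_vecIncl, rieszVecL_vecIncl hq1, mulVec_vecIncl,
    hsub, rieszVecL_vecIncl hq1]

lemma inner_eq_zero_of_mem {a b : LpT 2} (ha : a ∈ conjHardyZero 2) (hb : b ∈ hardy 2) :
    inner ℂ a b = 0 := by
  have h : rieszTwo a = 0 := by
    refine riesz_unique ENNReal.one_lt_two (rieszTwo_mem a) (sub_rieszTwo_mem a) (zero_mem _) ?_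
    rwa [sub_zero]
  have h2 := Submodule.sub_starProjection_mem_orthogonal (K := hardy 2) a
  rw [h, sub_zero] at h2
  exact Submodule.inner_left_of_mem_orthogonal hb h2

lemma inner_lpMul (m : LpT ∞) (a b : LpT 2) :
    inner ℂ a (lpMul m b : LpT 2) = inner ℂ (lpMul (star m) a : LpT 2) b := by
  rw [L2.inner_def, L2.inner_def]
  refine integral_congr_ae ?_
  filter_upwards [lpMul_coeFn (s := 2) m b, lpMul_coeFn (s := 2) (star m) a, Lp.coeFn_star m]
    with t h1 h2 h3
  rw [h1, h2, h3]
  simp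
  ring

lemma inner_mulVec (M : LpMat n ∞) (f g : LpVec n 2) :
    inner ℂ f (mulVec M g : LpVec n 2) = inner ℂ (mulVec (adj M) f : LpVec n 2) g := by
  simp only [PiLp.inner_apply, mulVec_apply, inner_sum, sum_inner]
  rw [Finset.sum_comm]
  exact Finset.sum_congr rfl fun i _ => Finset.sum_congr rfl fun j _ => inner_lpMul _ _ _

lemma starProjection_modelSpace (Θ : InnerFn n) (f : LpVec n 2) :
    (modelSpace Θ 2).starProjection f = modelProjL le_rfl Θ f := by
  have h12 := ENNReal.one_lt_two
  refine (Submodule.eq_starProjection_of_mem_orthogonal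
    (modelProjL_mem h12 le_rfl Θ f) ?_)
  rw [Submodule.mem_orthogonal]
  intro w hw
  obtain ⟨hw1, hw2⟩ := (mem_modelSpace_iff Θ).1 hw
  set h : LpVec n 2 := rieszVecL n le_rfl (mulVec (adj Θ.toMat) f : LpVec n 2) with hh
  set y : LpVec n 2 := f - mulVec Θ.toMat h with hy
  -- For `w ∈ K_Θ^2`, the first summand is orthogonal to `w` because `Θ^* w` is orthogonal to `H^2`,
  -- the second because `w` is in `H^2`.
  have e : f - modelProjL le_rfl Θ f = mulVec Θ.toMat h + (y - rieszVecL n le_rfl y) := by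
    rw [modelProjL_apply, ← hh, ← hy, hy]; abel
  rw [e, inner_add_right, inner_mulVec, PiLp.inner_apply, PiLp.inner_apply,
    Finset.sum_eq_zero, Finset.sum_eq_zero, add_zero]
  · intro i _
    rw [← inner_conj_symm]
    have h0 : inner ℂ ((y - rieszVecL n le_rfl y) i) (w i) = 0 :=
      inner_eq_zero_of_mem (sub_rieszL_mem h12 le_rfl (y i)) (hw1 i)
    rw [h0, map_zero]
  · intro i _
    exact inner_eq_zero_of_mem (hw2 i) (rieszL_mem h12 le_rfl _)

/-! ### Density of bounded functions in the model space -/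

/-- The bounded functions in `L^2`. -/
def bddTwo : Submodule ℂ (LpT 2) := LinearMap.range (lpInclL (le_top : (2 : ℝ≥0∞) ≤ ∞)).toLinearMap

lemma mono_mem_bddTwo (k : ℤ) : mono 2 k ∈ bddTwo := by
  refine ⟨mono ∞ k, Lp.ext ?_⟩
  have h1 := coeFn_fourierLp (T := (1 : ℝ)) 2 k
  have h2 := coeFn_fourierLp (T := (1 : ℝ)) ∞ k
  exact h2.trans h1.symm

lemma lpMul_mem_bddTwo (g : LpT ∞) {f : LpT 2} (hf : f ∈ bddTwo) :
    (lpMul g f : LpT 2) ∈ bddTwo := by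
  obtain ⟨u, rfl⟩ := hf
  exact ⟨lpMul g u, (lpMul_lpIncl le_top g u).symm⟩

lemma mulVec_mem_bddTwo (M : LpMat n ∞) {f : LpVec n 2} (hf : ∀ i, f i ∈ bddTwo) (i : Fin n) :
    (mulVec M f : LpVec n 2) i ∈ bddTwo := by
  rw [mulVec_apply]
  exact Submodule.sum_mem _ fun j _ => lpMul_mem_bddTwo _ (hf j)

/-- The product has no coefficients of index above `k`, so its projection to `H^2` is a polynomial
of degree at most `k`. -/
lemma rieszL_lpMul_mono_mem_bddTwo {g : LpT ∞} (hg : g ∈ hardy ∞) (k : ℕ) :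
    rieszL le_rfl (lpMul (star g) (mono 2 k) : LpT 2) ∈ bddTwo := by
  set h : LpT 2 := lpMul (star g) (mono 2 k) with hh
  have hk : ∀ m : ℤ, (k : ℤ) < m → fourierCoeff h m = 0 := fun m hm => by
    rw [hh, fourierCoeff_lpMul_fourierLp, fourierCoeff_star, hg _ (by lia), star_zero]
  set v : LpT 2 := ∑ m ∈ Finset.range (k + 1), fourierCoeff h m • mono 2 m with hv
  have hvc : ∀ m : ℤ, fourierCoeff v m = if 0 ≤ m ∧ m ≤ k then fourierCoeff h m else 0 := by
    intro m
    rw [← coeffCLM_apply, hv, map_sum]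
    simp only [map_smul, coeffCLM_apply, fourierCoeff_fourierLp, smul_eq_mul, mul_ite, mul_one,
      mul_zero]
    split_ifs with hm
    · lift m to ℕ using hm.1
      simp only [Nat.cast_inj]
      rw [Finset.sum_ite_eq, if_pos (Finset.mem_range.2 (by lia))]
    · refine Finset.sum_eq_zero fun j hj => if_neg ?_
      have := Finset.mem_range.1 hj
      lia
  have e : rieszL le_rfl h = v := by
    refine riesz_unique ENNReal.one_lt_two (rieszL_mem ENNReal.one_lt_two le_rfl h)
      (sub_rieszL_mem ENNReal.one_lt_two le_rfl h) (fun m hm => ?_)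
      (mem_conjHardyZero_iff.2 fun m hm => ?_)
    · rw [hvc, if_neg (by lia)]
    · rw [← coeffCLM_apply, map_sub, coeffCLM_apply, coeffCLM_apply, hvc]
      split_ifs with h'
      · exact sub_self _
      · rw [hk m (by lia), sub_zero]
  rw [e]
  exact Submodule.sum_mem _ fun m _ => Submodule.smul_mem _ _ (mono_mem_bddTwo m)

/-- The column with the entry `a` at `j` and zeros elsewhere. -/
def vecSingle (j : Fin n) : LpT 2 →L[ℂ] LpVec n 2 where
  toFun a := WithLp.toLp 2 (Pi.single j a)
  map_add' a b := PiLp.ext fun i => by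
    change (Pi.single j (a + b) : Fin n → LpT 2) i =
      (Pi.single j a : Fin n → LpT 2) i + (Pi.single j b : Fin n → LpT 2) i
    rw [Pi.single_add, Pi.add_apply]
  map_smul' c a := PiLp.ext fun i => by
    change (Pi.single j (c • a) : Fin n → LpT 2) i = c • (Pi.single j a : Fin n → LpT 2) i
    by_cases h : i = j
    · subst h; rw [Pi.single_eq_same, Pi.single_eq_same]
    · rw [Pi.single_eq_of_ne h, Pi.single_eq_of_ne h, smul_zero]
  cont := (PiLp.continuous_toLp 2 _).comp (continuous_single (A := fun _ : Fin n => LpT 2) j)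

lemma vecSingle_apply (j i : Fin n) (a : LpT 2) :
    vecSingle j a i = (Pi.single j a : Fin n → LpT 2) i := rfl

lemma sum_vecSingle (f : LpVec n 2) : ∑ j, vecSingle j (f j) = f := by
  refine PiLp.ext fun i => ?_
  have h := congrFun (Finset.univ_sum_single (fun j => f j)) i
  rw [Finset.sum_apply] at h
  rw [WithLp.ofLp_sum, Finset.sum_apply]
  exact h

lemma mulVec_vecSingle (M : LpMat n ∞) (j i : Fin n) (a : LpT 2) :
    (mulVec M (vecSingle j a) : LpVec n 2) i = lpMul (M i j) a := by
  rw [mulVec_apply, Finset.sum_eq_single j]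
  · rw [vecSingle_apply, Pi.single_eq_same]
  · intro l _ hl
    rw [vecSingle_apply, Pi.single_eq_of_ne hl, map_zero]
  · simp

/-- For `k < 0` the projection is zero. For `k ≥ 0` it is `z^k e_j` minus `Θ` times a column of
polynomials; this already lies in `H^2`, so the outer Riesz projection fixes it. -/
lemma modelProjL_vecSingle_mono_mem_bddTwo (Θ : InnerFn n) (j : Fin n) (k : ℤ) (i : Fin n) :
    modelProjL le_rfl Θ (vecSingle j (mono 2 k)) i ∈ bddTwo := by
  have h12 := ENNReal.one_lt_two
  rcases lt_or_ge k 0 with hk | hk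
  · have hx : ∀ i, vecSingle j (mono 2 k) i ∈ conjHardyZero 2 := by
      intro i
      rw [vecSingle_apply, mem_conjHardyZero_iff]
      intro m hm
      by_cases hij : i = j
      · subst hij
        rw [Pi.single_eq_same, fourierCoeff_fourierLp, if_neg (by lia)]
      · rw [Pi.single_eq_of_ne hij]
        exact (coeffCLM (p := 2) m).map_zero
    have h0 : rieszVecL n le_rfl (mulVec (adj Θ.toMat) (vecSingle j (mono 2 k)) : LpVec n 2) = 0 :=
      PiLp.ext fun i => rieszL_of_mem_conjHardyZero h12 le_rfl
        (adj_mulVec_mem_conjHardyZero h12 le_rfl Θ hx i)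
    rw [modelProjL_apply, h0, map_zero, sub_zero, vecMapL_apply,
      rieszL_of_mem_conjHardyZero h12 le_rfl (hx i)]
    exact zero_mem _
  · lift k to ℕ using hk
    have hx : ∀ i, vecSingle j (mono 2 k) i ∈ hardy 2 := by
      intro i
      rw [vecSingle_apply]
      by_cases hij : i = j
      · subst hij
        rw [Pi.single_eq_same]
        intro m hm
        rw [fourierCoeff_fourierLp, if_neg (by lia)]
      · rw [Pi.single_eq_of_ne hij]
        exact zero_mem _
    have hb : ∀ i, vecSingle j (mono 2 k) i ∈ bddTwo := by
      intro i
      rw [vecSingle_apply]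
      by_cases hij : i = j
      · subst hij
        rw [Pi.single_eq_same]
        exact mono_mem_bddTwo _
      · rw [Pi.single_eq_of_ne hij]
        exact zero_mem _
    rw [modelProjL_apply, vecMapL_apply, rieszL_of_mem_hardy h12 le_rfl]
    · refine sub_mem (hb i) (mulVec_mem_bddTwo _ (fun l => ?_) i)
      rw [vecMapL_apply, mulVec_vecSingle]
      exact rieszL_lpMul_mono_mem_bddTwo (Θ.analytic j l) k
    · exact sub_mem (hx i) (mulVec_mem_hardy h12 le_rfl Θ (fun l => rieszL_mem h12 le_rfl _) i)

/-- The bounded functions are dense in the model space. -/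
lemma mem_closure_bounded (Θ : InnerFn n) {f : LpVec n 2} (hf : f ∈ modelSpace Θ 2) :
    f ∈ closure {g : LpVec n 2 | g ∈ modelSpace Θ 2 ∧ ∃ u : LpVec n ∞, vecIncl le_top u = g} := by
  have h12 := ENNReal.one_lt_two
  let S : Submodule ℂ (LpVec n 2) :=
    LinearMap.range (vecMapL (n := n) (lpInclL (le_top : (2 : ℝ≥0∞) ≤ ∞))).toLinearMap
  -- `D` consists of the columns with bounded projection. It contains all `z^k e_j`, hence is dense,
  -- and the projection carries this density to `K_Θ^2`.
  let D : Submodule ℂ (LpVec n 2) := S.comap (modelProjL le_rfl Θ).toLinearMap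
  have hS : ∀ g : LpVec n 2, (∀ i, g i ∈ bddTwo) → g ∈ S := fun g hg => by
    choose u hu using hg
    exact ⟨WithLp.toLp 2 u, PiLp.ext hu⟩
  have hs : ∀ (j : Fin n) (a : LpT 2), vecSingle j a ∈ D.topologicalClosure := by
    intro j a
    have h1 : Submodule.span ℂ (Set.range (mono 2)) ≤ D.comap (vecSingle j).toLinearMap := by
      rw [Submodule.span_le]
      rintro _ ⟨k, rfl⟩
      exact hS _ (modelProjL_vecSingle_mono_mem_bddTwo Θ j k)
    have h2 : a ∈ (Submodule.span ℂ (Set.range (mono 2))).topologicalClosure := by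
      rw [span_fourierLp_closure_eq_top (p := 2) ENNReal.ofNat_ne_top]; trivial
    exact map_mem_closure (vecSingle j).continuous h2 fun x hx => h1 hx
  have hD : f ∈ closure (D : Set (LpVec n 2)) := by
    rw [← sum_vecSingle f]
    exact Submodule.sum_mem D.topologicalClosure fun j _ => hs j (f j)
  have hpf : modelProjL le_rfl Θ f = f := by
    rw [← starProjection_modelSpace]
    exact Submodule.starProjection_eq_self_iff.2 hf
  rw [← hpf]
  refine map_mem_closure (modelProjL le_rfl Θ).continuous hD fun x hx => ?_
  exact ⟨modelProjL_mem h12 le_rfl Θ x, hx⟩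

/-! ### Exponents, and the two implications -/

lemma le_two_of_holderTriple [ENNReal.HolderTriple p 2 q] : q ≤ 2 := by
  rw [← ENNReal.inv_le_inv, ← ENNReal.HolderTriple.inv_add_inv_eq_inv p 2 q]
  exact le_add_self

lemma one_lt_of_holderTriple [ENNReal.HolderTriple p 2 q] (hp : 2 < p) : 1 < q := by
  rw [← ENNReal.inv_lt_inv, ← ENNReal.HolderTriple.inv_add_inv_eq_inv p 2 q, inv_one,
    ← ENNReal.inv_two_add_inv_two]
  exact ENNReal.add_lt_add_right (by simp) (ENNReal.inv_lt_inv.2 hp)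

lemma vecIncl_mulVec_matIncl [ENNReal.HolderTriple p 2 q] (hp : 2 ≤ p) (hq : q ≤ 2)
    (G : LpMat n p) (f : LpVec n ∞) :
    vecIncl hq (mulVec (matIncl hp G) f : LpVec n 2) =
      (mulVec G (vecIncl le_top f : LpVec n 2) : LpVec n q) := by
  refine PiLp.ext fun i => Lp.ext ?_
  refine (coeFn_mulVec (s := 2) (matIncl hp G) f i).trans ?_
  exact (coeFn_mulVec (s := q) G (vecIncl le_top f : LpVec n 2) i).symm

/-- Membership is a condition on the Fourier coefficients of `f` and `Θ^* f`, which do not depend on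
the exponent. -/
lemma vecIncl_mem_modelSpace [Fact (1 ≤ q)] (hq : q ≤ 2) (Θ : InnerFn n) {f : LpVec n 2} :
    vecIncl hq f ∈ modelSpace Θ q ↔ f ∈ modelSpace Θ 2 := by
  rw [mem_modelSpace_iff, mem_modelSpace_iff, mulVec_vecIncl]
  exact and_congr Iff.rfl (forall_congr' fun i => lpIncl_mem_conjHardyZero hq)

lemma memModelSpaceTwo_iff (hq : q ≤ 2) (Θ : InnerFn n) {g : LpVec n q} :
    MemModelSpaceTwo Θ g ↔ ∃ h ∈ modelSpace Θ 2, vecIncl hq h = g := by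
  refine exists_congr fun h => and_congr Iff.rfl ⟨fun H => PiLp.ext fun i => Subtype.ext (H i), ?_⟩
  rintro rfl i
  rfl

lemma memL2_iff (hq : q ≤ 2) {g : LpVec n q} : MemL2 g ↔ ∃ h : LpVec n 2, vecIncl hq h = g := by
  constructor
  · intro H
    exact ⟨WithLp.toLp 2 fun i => ⟨_, H i⟩, PiLp.ext fun i => Subtype.ext rfl⟩
  · rintro ⟨h, rfl⟩ i
    exact (h i).2

lemma memL2_iff_memModelSpaceTwo [Fact (1 ≤ q)] (hq : q ≤ 2) (Θ : InnerFn n) {g : LpVec n q}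
    (hg : g ∈ modelSpace Θ q) : MemL2 g ↔ MemModelSpaceTwo Θ g := by
  rw [memL2_iff hq, memModelSpaceTwo_iff hq]
  constructor
  · rintro ⟨h, rfl⟩
    exact ⟨h, (vecIncl_mem_modelSpace hq Θ).1 hg, rfl⟩
  · rintro ⟨h, -, hh⟩
    exact ⟨h, hh⟩

/-- The link between the two operators: on bounded functions they agree once `L^2` is included in
`L^q`. -/
lemma vecIncl_starProjection [Fact (1 ≤ q)] [ENNReal.HolderTriple p 2 q] (hp : 2 < p)
    (hq : q ≤ 2) (Θ : InnerFn n) (G : LpMat n p) (u : LpVec n ∞) :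
    vecIncl hq ((modelSpace Θ 2).starProjection (mulVec (matIncl hp.le G) u : LpVec n 2)) =
      modelProjL hq Θ (mulVec G (vecIncl le_top u : LpVec n 2) : LpVec n q) := by
  rw [starProjection_modelSpace, ← modelProjL_vecIncl (one_lt_of_holderTriple hp),
    vecIncl_mulVec_matIncl]

lemma memModelSpaceTwo_of_isMTTO [Fact (1 ≤ q)] [ENNReal.HolderTriple p 2 q] (hp : 2 < p)
    (hq : q ≤ 2) (Θ : InnerFn n) {G : LpMat n p} (hG : IsMTTO Θ (matIncl hp.le G))
    {f : LpVec n 2} (hf : f ∈ modelSpace Θ 2) :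
    ∃ h ∈ modelSpace Θ 2, vecIncl hq h = modelProjL hq Θ (mulVec G f : LpVec n q) := by
  obtain ⟨C, hC⟩ := hG
  obtain ⟨x, hx, hxf⟩ := mem_closure_iff_seq_limit.1 (mem_closure_bounded Θ hf)
  choose hxm u hu using hx
  set Y : LpVec n ∞ →ₗ[ℂ] LpVec n 2 := (modelSpace Θ 2).starProjection.toLinearMap ∘ₗ
    (mulVec (matIncl hp.le G) : LpVec n ∞ →ₗ[ℂ] LpVec n 2) with hY
  have hsub : ∀ m k, vecIncl le_top (u m - u k) = x m - x k := fun m k => by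
    rw [← hu m, ← hu k]; rfl
  -- The difference `u m - u k` is itself an admissible test function. The absolute value is taken
  -- because `C` is not assumed nonnegative.
  have hbd : ∀ m k, ‖Y (u m) - Y (u k)‖ ≤ |C| * ‖x m - x k‖ := fun m k => by
    rw [← map_sub, ← hsub]
    refine (hC (u m - u k) (fun i => ?_) ?_).trans
      (mul_le_mul_of_nonneg_right (le_abs_self C) (norm_nonneg _))
    · have h := (sub_mem (hxm m) (hxm k)).1 i
      rw [← hsub] at h
      exact h
    · rw [hsub]; exact sub_mem (hxm m) (hxm k)
  have hcau : CauchySeq fun m => Y (u m) := by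
    rw [Metric.cauchySeq_iff']
    intro ε hε
    obtain ⟨N, hN⟩ := Metric.cauchySeq_iff'.1 hxf.cauchySeq (ε / (|C| + 1)) (by positivity)
    refine ⟨N, fun m hm => ?_⟩
    rw [dist_eq_norm]
    have h := hN m hm
    rw [dist_eq_norm, lt_div_iff₀ (by positivity)] at h
    refine (hbd m N).trans_lt (lt_of_le_of_lt ?_ h)
    nlinarith [norm_nonneg (x m - x N)]
  obtain ⟨y, hy⟩ := cauchySeq_tendsto_of_complete hcau
  refine ⟨y, (isClosed_modelSpace Θ).mem_of_tendsto hy (Filter.Eventually.of_forall fun m =>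
    Submodule.starProjection_apply_mem _ _), ?_⟩
  have h1 : Filter.Tendsto (fun m => vecIncl hq (Y (u m))) Filter.atTop (nhds (vecIncl hq y)) :=
    ((vecMapL (lpInclL hq)).continuous.tendsto y).comp hy
  have h2 : Filter.Tendsto (fun m => modelProjL hq Θ (mulVec G (x m) : LpVec n q)) Filter.atTop
      (nhds (modelProjL hq Θ (mulVec G f : LpVec n q))) :=
    (((modelProjL hq Θ).continuous.comp (continuous_mulVec G)).tendsto f).comp hxf
  -- The sequences coincide in `L^q`, so the `L^2` limit `y` represents the modified operator at
  -- `f`.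
  refine tendsto_nhds_unique h1 (h2.congr fun m => ?_)
  rw [← hu m, ← vecIncl_starProjection hp hq]
  rfl

lemma isMTTO_of_memModelSpaceTwo [Fact (1 ≤ q)] [ENNReal.HolderTriple p 2 q] (hp : 2 < p)
    (hq : q ≤ 2) (Θ : InnerFn n) {G : LpMat n p}
    (h : ∀ f : modelSpace Θ 2, ∃ h ∈ modelSpace Θ 2,
      vecIncl hq h = modelProjL hq Θ (mulVec G (f : LpVec n 2) : LpVec n q)) :
    IsMTTO Θ (matIncl hp.le G) := by
  choose B hB hBeq using h
  have hinj := vecIncl_injective (n := n) hq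
  -- The `L^2` representatives were merely chosen; linearity is inherited from the `L^q` operator
  -- because the inclusion is injective.
  let L : modelSpace Θ 2 →ₗ[ℂ] LpVec n 2 :=
    { toFun := B
      map_add' := fun f g => hinj <| by
        rw [vecIncl_eq_vecMapL, vecIncl_eq_vecMapL, map_add, ← vecIncl_eq_vecMapL,
          ← vecIncl_eq_vecMapL, ← vecIncl_eq_vecMapL, hBeq, hBeq, hBeq, Submodule.coe_add,
          map_add, map_add]
      map_smul' := fun c f => hinj <| by
        rw [RingHom.id_apply, vecIncl_eq_vecMapL, vecIncl_eq_vecMapL, map_smul,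
          ← vecIncl_eq_vecMapL, ← vecIncl_eq_vecMapL, hBeq, hBeq, Submodule.coe_smul,
          map_smul, map_smul] }
  have hL : Continuous L := by
    -- Closed graph: an `L^2` limit of `L (v m)` is also its `L^q` limit, which continuity of the
    -- modified operator identifies.
    refine L.continuous_of_seq_closed_graph fun v x y hv hLv => hinj ?_
    have h1 : Filter.Tendsto (fun m => vecIncl hq (L (v m))) Filter.atTop
        (nhds (vecIncl hq y)) := ((vecMapL (lpInclL hq)).continuous.tendsto y).comp hLv
    have h2 : Filter.Tendsto (fun m => modelProjL hq Θ (mulVec G (v m : LpVec n 2) : LpVec n q))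
        Filter.atTop (nhds (modelProjL hq Θ (mulVec G (x : LpVec n 2) : LpVec n q))) :=
      ((((modelProjL hq Θ).continuous.comp (continuous_mulVec G)).comp
        continuous_subtype_val).tendsto x).comp hv
    exact (tendsto_nhds_unique h1 (h2.congr fun m => (hBeq (v m)).symm)).trans (hBeq x).symm
  refine ⟨‖(⟨L, hL⟩ : modelSpace Θ 2 →L[ℂ] LpVec n 2)‖, fun u _ hu => ?_⟩
  have e : (modelSpace Θ 2).starProjection (mulVec (matIncl hp.le G) u : LpVec n 2) =
      L ⟨vecIncl le_top u, hu⟩ := hinj <| by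
    rw [vecIncl_starProjection hp hq]
    exact (hBeq ⟨vecIncl le_top u, hu⟩).symm
  rw [e]
  exact (⟨L, hL⟩ : modelSpace Θ 2 →L[ℂ] LpVec n 2).le_opNorm ⟨vecIncl le_top u, hu⟩

end MTTO

end

/-! ### The theorem -/

theorem mainTheorem6 (n : ℕ) (p q : ℝ≥0∞) [Fact (1 ≤ q)] [ENNReal.HolderTriple p 2 q]
    (hp : 2 < p) (Θ : MTTO.InnerFn n) :
    (∀ G : MTTO.LpMat n p,
      (∃ A : MTTO.modelSpace Θ 2 →L[ℂ] MTTO.modelSpace Θ q,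
        ∀ f, (A f : MTTO.LpVec n q) = MTTO.modifiedMTTO Θ q G f) ∧
      (MTTO.IsMTTO Θ (MTTO.matIncl hp.le G) ↔
        ∀ f, MTTO.MemModelSpaceTwo Θ (MTTO.modifiedMTTO Θ q G f))) ∧
    {G : MTTO.LpMat n p | MTTO.IsMTTO Θ (MTTO.matIncl hp.le G)} =
      {G : MTTO.LpMat n p | ∀ f, MTTO.MemL2 (MTTO.modifiedMTTO Θ q G f)} := by
  have hq : q ≤ 2 := MTTO.le_two_of_holderTriple (p := p)
  have hq1 : 1 < q := MTTO.one_lt_of_holderTriple hp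
  have hmod : ∀ (G : MTTO.LpMat n p) (f : MTTO.modelSpace Θ 2), MTTO.modifiedMTTO Θ q G f =
      MTTO.modelProjL hq Θ (MTTO.mulVec G (f : MTTO.LpVec n 2) : MTTO.LpVec n q) :=
    fun G f => MTTO.modelProj_eq_modelProjL hq1 hq Θ _
  have hmem : ∀ (G : MTTO.LpMat n p) (f : MTTO.modelSpace Θ 2),
      MTTO.modifiedMTTO Θ q G f ∈ MTTO.modelSpace Θ q := fun G f => by
    rw [hmod]; exact MTTO.modelProjL_mem hq1 hq Θ _
  have hiff : ∀ G : MTTO.LpMat n p, MTTO.IsMTTO Θ (MTTO.matIncl hp.le G) ↔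
      ∀ f, MTTO.MemModelSpaceTwo Θ (MTTO.modifiedMTTO Θ q G f) := fun G => by
    simp only [MTTO.memModelSpaceTwo_iff hq, hmod]
    exact ⟨fun h f => MTTO.memModelSpaceTwo_of_isMTTO hp hq Θ h f.2,
      MTTO.isMTTO_of_memModelSpaceTwo hp hq Θ⟩
  refine ⟨fun G => ⟨?_, hiff G⟩, ?_⟩
  · refine ⟨((MTTO.modelProjL hq Θ).comp ((MTTO.mulVecL G).comp
      (MTTO.modelSpace Θ 2).subtypeL)).codRestrict (MTTO.modelSpace Θ q)
        fun f => MTTO.modelProjL_mem hq1 hq Θ _, fun f => (hmod G f).symm⟩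
  · ext G
    refine (hiff G).trans (forall_congr' fun f => ?_)
    -- The values already lie in `K_Θ^q`, where belonging to `L^2` and to `K_Θ^2` are equivalent.
    exact (MTTO.memL2_iff_memModelSpaceTwo hq Θ (hmem G f)).symm
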